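/- Conventions. Identify a finite set of natural numbers with the increasing sequence of its elements; $s\le_{in}X$ means that $s$ is an initial segment of $X\subseteq\mathbb N$, and $s\vartriangleleft t$ means that there is a finite $r\subset\mathbb N$ of which $s$ is a proper initial segment and such that $t$ is $r$ with its least element removed. A *barrier* is an infinite family $B$ of finite subsets of $\mathbb N$, pairwise incomparable under inclusion, such that every infinite $X\subseteq\bigcup B$ has a nonempty initial segment in $B$; its order type is that of the lexicographic order on $B$ (a well-order). Let $\alpha$ be an ordinal. A quasi-ordered set $Q$ is *$\alpha$-bqo* if for every barrier $B$ of order type at most $\alpha$ and every map $f:B\to Q$ there are $s,t\in B$ with $s\vartriangleleft t$ and $f(s)\le f(t)$; $Q$ is *bqo* if it is $\alpha$-bqo for every countably infinite ordinal $\alpha$, and *wqo* if every infinite sequence $(q_n)$ in $Q$ has indices $m<n$ with $q_m\le q_n$ (equivalently, $Q$ is well-founded without infinite antichains). For a poset $P$ and $X,Y\subseteq P$, $X$ is *dominated* by $Y$ if every $x\in X$ is below some $y\in Y$. Let $\mathfrak P(P)$ be the power set of $P$, $\mathfrak P_{\le\omega}(P)$ the set of (finite or infinite) countable subsets of $P$,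 and $S_\omega(P)$ the set of strictly increasing sequences $(x_n)_{n<\omega}$ in $P$, all quasi-ordered by domination (for sequences: $(x_n)\le(y_n)$ if every $x_n$ is below some $y_m$). Theorem. Let $P$ be a poset and let $\alpha$ be a countably infinite ordinal. The following are equivalent: 1. $P$ is $\alpha\omega$-bqo; 2. $P$ is $\omega$-bqo and $S_\omega(P)$ is $\alpha$-bqo; 3. $P$ is wqo and $S_\omega(P)$ is $\alpha$-bqo; 4. $\mathfrak P_{\le\omega}(P)$ is $\alpha$-bqo; 5. $\mathfrak P(P)$ is $\alpha$-bqo. In particular, if $P$ is wqo and $S_\omega(P)$ is bqo, then $P$ is bqo. -/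

import Mathlib

open scoped Ordinal

/-!
Finite sets of natural numbers are identified with strictly increasing finite sequences
(their elements listed in increasing order).
-/

namespace Bqo

/-- `s ≤_in X`: the finite set `s` is an initial segment of the (finite or infinite) set `X`. -/
def IsInitSeg (s : Finset ℕ) (X : Set ℕ) : Prop :=
  (s : Set ℕ) ⊆ X ∧ ∀ x ∈ X, ∀ y ∈ s, x ≤ y → x ∈ s

/-- `*r`: the set `r` with its least element deleted (and `*∅ = ∅`). -/
def tail (r : Finset ℕ) : Finset ℕ :=
  r.filter fun x => ∃ y ∈ r, y < x

/-- `s ◁ t`: there is a finite `r` with `s <_in r` and `t = *r`. -/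
def Shift (s t : Finset ℕ) : Prop :=
  ∃ r : Finset ℕ, IsInitSeg s (r : Set ℕ) ∧ s ≠ r ∧ t = tail r

/-- The strict lexicographic order on finite sets of natural numbers. -/
def LexLT (s t : Finset ℕ) : Prop :=
  List.Lex (· < ·) (s.sort (· ≤ ·)) (t.sort (· ≤ ·))

/-- `⋃ B`. -/
def base (B : Set (Finset ℕ)) : Set ℕ :=
  {n | ∃ s ∈ B, n ∈ s}

/-- Blocks: infinite families `B` such that every infinite `X ⊆ ⋃ B` has a nonempty
initial segment in `B`. -/
def IsBlock (B : Set (Finset ℕ)) : Prop :=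
  B.Infinite ∧ ∀ X : Set ℕ, X.Infinite → X ⊆ base B → ∃ s ∈ B, s.Nonempty ∧ IsInitSeg s X

/-- Barriers: blocks that are antichains for inclusion. -/
def IsBarrier (B : Set (Finset ℕ)) : Prop :=
  IsBlock B ∧ IsAntichain (· ⊆ ·) B

/-- `B` is well ordered by the lexicographic order, with order type at most `α`. -/
def OrderTypeLE (B : Set (Finset ℕ)) (α : Ordinal.{0}) : Prop :=
  ∃ _ : IsWellOrder B (fun s t => LexLT s.1 t.1),
    Ordinal.type (fun s t : B => LexLT s.1 t.1) ≤ α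

/-- A map from `B` into a set quasi-ordered by `r` is good. -/
def IsGood {Q : Type*} (r : Q → Q → Prop) {B : Set (Finset ℕ)} (f : B → Q) : Prop :=
  ∃ s t : B, Shift s.1 t.1 ∧ r (f s) (f t)

/-- `(Q, r)` is `α`-better-quasi-ordered: every map from a barrier of order type at most `α`
into `Q` is good. -/
def IsAlphaBqo {Q : Type*} (r : Q → Q → Prop) (α : Ordinal.{0}) : Prop :=
  ∀ B : Set (Finset ℕ), IsBarrier B → OrderTypeLE B α → ∀ f : B → Q, IsGood r f

/-- `(Q, r)` is better-quasi-ordered: `α`-better-quasi-ordered for all denumerable `α`. -/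
def IsBqo {Q : Type*} (r : Q → Q → Prop) : Prop :=
  ∀ α : Ordinal.{0}, ω ≤ α → α < ω₁ → IsAlphaBqo r α

/-- The domination quasi-order on the power set of `P`. -/
def Dom {P : Type*} [LE P] (X Y : Set P) : Prop :=
  ∀ x ∈ X, ∃ y ∈ Y, x ≤ y

/-- The domination quasi-order on the set of (at most) countable subsets of `P`. -/
def CountableDom {P : Type*} [LE P] (X Y : {X : Set P // X.Countable}) : Prop :=
  Dom X.1 Y.1

/-- `S_ω(P)`: the strictly increasing `ω`-sequences of elements of `P`. -/
def IncSeq (P : Type*) [Preorder P] : Type _ :=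
  {x : ℕ → P // StrictMono x}

/-- The domination quasi-order on `S_ω(P)`. -/
def IncSeqDom {P : Type*} [Preorder P] (x y : IncSeq P) : Prop :=
  ∀ n : ℕ, ∃ m : ℕ, x.1 n ≤ y.1 m

end Bqo

namespace Bqo

/-! ### Initial segments -/

/-! The cycle is 1 → 5 → 4 → 2 → 3 → 4 → 1; restriction to countable sets, singletons and ranges of
sequences give 5 → 4 → 2, and the barrier of singletons gives 2 → 3. Three implications carry the
content, and in each a bad map on one barrier is turned into a bad map on another whose order type
is controlled.

1 → 5 (`isAlphaBqo_dom`). If `F` is a bad map from `B` to sets, each pair `s ◁ t` has a witness `x ∈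
F s` below nothing in `F t`. Attached to `s ∪ t`, these witnesses form a bad map on `square B`,
whose type is at most `α * ω`: the least element comes first, then the rank of the tail.

3 → 4. First, `P` itself is `α`-bqo (`isAlphaBqo_of_incSeq`): a bad map into `P` factors through a
front of shortest initial segments that determine its value. One-point extensions of a fixed `s`
then have no infinite constant subfamily, so wqo and thinning make them strictly increasing.
Deleting last elements gives a bad map into `S_ω(P)` on initial segments of members of `B`, so the
type does not grow. Next, a subset of a wqo set is a finite union of directed sets. Ramsey arguments
select one directed piece of each `F s` that still contains all witnesses. A countable directed set
has either a largest element or a cofinal strictly increasing sequence, so the bad map yields one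
into `P` or into `S_ω(P)`.

4 → 1 (`isAlphaBqo_mul_omega0`). One has `α * ω = ω ^ γ * ω` with `ω ^ γ ≤ α`. Given a bad map into
`P` on a barrier of type at most `ω ^ γ * ω`, thinning ranks the members with a fixed least element
below `ω ^ γ`. The sets `t` just long enough to determine a member of `B` inside `{n} ∪ t`, for
every smaller `n`, form a barrier `resolvent B X`. A natural sum of finitely many ranks keeps its
type at most `ω ^ γ`, since powers of `ω` are closed under natural sums. Collecting the values of
the map over the determined members gives a bad map into countable sets.

All thinning rests on `fusion` and on Galvin's partition theorem `galvin`. -/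

theorem IsInitSeg.refl (s : Finset ℕ) : IsInitSeg s (s : Set ℕ) :=
  ⟨subset_rfl, fun _ hx _ _ _ => hx⟩

theorem IsInitSeg.subset {s t : Finset ℕ} (h : IsInitSeg s (t : Set ℕ)) : s ⊆ t :=
  Finset.coe_subset.1 h.1

theorem IsInitSeg.trans {s t : Finset ℕ} {X : Set ℕ} (h : IsInitSeg s (t : Set ℕ))
    (h' : IsInitSeg t X) : IsInitSeg s X :=
  ⟨h.1.trans h'.1, fun x hx y hy hxy => h.2 x (h'.2 x hx y (h.1 hy) hxy) y hy hxy⟩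

theorem IsInitSeg.mono {s : Finset ℕ} {X Y : Set ℕ} (h : IsInitSeg s X) (hs : (s : Set ℕ) ⊆ Y)
    (hY : Y ⊆ X) : IsInitSeg s Y :=
  ⟨hs, fun x hx y hy hxy => h.2 x (hY hx) y hy hxy⟩

theorem IsInitSeg.comparable {s t : Finset ℕ} {X : Set ℕ} (hs : IsInitSeg s X)
    (ht : IsInitSeg t X) : IsInitSeg s (t : Set ℕ) ∨ IsInitSeg t (s : Set ℕ) := by
  by_cases h : s ⊆ t
  · exact Or.inl (hs.mono (Finset.coe_subset.2 h) ht.1)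
  · obtain ⟨a, has, hat⟩ := Finset.not_subset.1 h
    refine Or.inr (ht.mono (fun y hy => ?_) hs.1)
    rcases le_total y a with hya | hay
    · exact hs.2 y (ht.1 hy) a has hya
    · exact absurd (ht.2 a (hs.1 has) y hy hay) hat

theorem IsInitSeg.insert_lt {s : Finset ℕ} {X : Set ℕ} {n : ℕ} (h : IsInitSeg s X)
    (hn : ∀ x ∈ X, n < x) : IsInitSeg (insert n s) (insert n X) := by
  refine ⟨by simpa using Set.insert_subset_insert h.1, fun x hx y hy hxy => ?_⟩
  rcases hx with rfl | hx
  · simp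
  · rcases Finset.mem_insert.1 hy with rfl | hy
    · exact absurd (hn x hx) (not_lt.2 hxy)
    · exact Finset.mem_insert_of_mem (h.2 x hx y hy hxy)

theorem isInitSeg_union {s : Finset ℕ} {Y : Set ℕ} (h : ∀ x ∈ Y, ∀ y ∈ s, y < x) :
    IsInitSeg s ((s : Set ℕ) ∪ Y) :=
  ⟨Set.subset_union_left, fun x hx y hy hxy =>
    hx.elim id fun hx => absurd (h x hx y hy) (not_lt.2 hxy)⟩

theorem IsInitSeg.lt_of_notMem {s : Finset ℕ} {X : Set ℕ} (h : IsInitSeg s X) {x : ℕ}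
    (hx : x ∈ X) (hxs : x ∉ s) : ∀ y ∈ s, y < x :=
  fun y hy => lt_of_not_ge fun hxy => hxs (h.2 x hx y hy hxy)

theorem IsInitSeg.insert_next {s t : Finset ℕ} {X : Set ℕ} (hs : IsInitSeg s X)
    (ht : IsInitSeg t X) (hst : IsInitSeg s (t : Set ℕ)) (hne : s ≠ t) :
    ∃ k ∈ t, k ∉ s ∧ IsInitSeg (insert k s) X := by
  have hnon : (t \ s).Nonempty := by
    rw [Finset.sdiff_nonempty]
    exact fun h => hne (Finset.Subset.antisymm hst.subset h)
  have hk := (t \ s).min'_mem hnon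
  set k := (t \ s).min' hnon
  rw [Finset.mem_sdiff] at hk
  refine ⟨k, hk.1, hk.2, ?_, fun x hx y hy hxy => ?_⟩
  · intro x hx
    rcases Finset.mem_insert.1 (Finset.mem_coe.1 hx) with rfl | hx
    · exact ht.1 hk.1
    · exact hs.1 hx
  · rcases Finset.mem_insert.1 hy with rfl | hy
    · by_cases hxs : x ∈ s
      · exact Finset.mem_insert_of_mem hxs
      · have hxt : x ∈ t := ht.2 x hx k hk.1 hxy
        have : k ≤ x := Finset.min'_le _ _ (Finset.mem_sdiff.2 ⟨hxt, hxs⟩)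
        exact Finset.mem_insert.2 (Or.inl (le_antisymm hxy this))
    · exact Finset.mem_insert_of_mem (hs.2 x hx y hy hxy)

/-! ### Fusion -/

/-- The elements of `X` that lie above all elements of `s`. -/
def above (s : Finset ℕ) (X : Set ℕ) : Set ℕ :=
  {x ∈ X | ∀ y ∈ s, y < x}

theorem above_subset (s : Finset ℕ) (X : Set ℕ) : above s X ⊆ X :=
  Set.sep_subset _ _

theorem above_empty (X : Set ℕ) : above ∅ X = X := by
  simp [above]

theorem infinite_inter_Ioi {X : Set ℕ} (hX : X.Infinite) (n : ℕ) : {x ∈ X | n < x}.Infinite := by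
  refine (hX.sdiff (Set.finite_Iic n)).mono fun x hx => ⟨hx.1, ?_⟩
  simpa using hx.2

theorem above_infinite (s : Finset ℕ) {X : Set ℕ} (hX : X.Infinite) : (above s X).Infinite := by
  refine (infinite_inter_Ioi hX (s.sup id)).mono fun x hx => ⟨hx.1, fun y hy => ?_⟩
  exact (Finset.le_sup (f := id) hy).trans_lt hx.2

theorem isInitSeg_union_above (s : Finset ℕ) (X : Set ℕ) :
    IsInitSeg s ((s : Set ℕ) ∪ above s X) :=
  isInitSeg_union fun _ hx => hx.2

theorem fusion_finite {Φ : Finset ℕ → Set ℕ → Prop} {M : Set ℕ}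
    (her : ∀ s Y Z, Z ⊆ Y → Φ s Y → Φ s Z)
    (dense : ∀ s : Finset ℕ, (s : Set ℕ) ⊆ M → ∀ Y ⊆ above s M, Y.Infinite →
      ∃ Z ⊆ Y, Z.Infinite ∧ Φ s Z) (F : Finset (Finset ℕ)) :
    ∀ Y : Set ℕ, Y.Infinite → (∀ s ∈ F, (s : Set ℕ) ⊆ M) → (∀ s ∈ F, Y ⊆ above s M) →
      ∃ Z ⊆ Y, Z.Infinite ∧ ∀ s ∈ F, Φ s Z := by
  induction F using Finset.induction_on with
  | empty => exact fun Y hY _ _ => ⟨Y, subset_rfl, hY, by simp⟩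
  | insert s F _ ih =>
    intro Y hY hF hYF
    obtain ⟨Z, hZY, hZ, hΦ⟩ := ih Y hY (fun t ht => hF t (Finset.mem_insert_of_mem ht))
      (fun t ht => hYF t (Finset.mem_insert_of_mem ht))
    obtain ⟨W, hWZ, hW, hs⟩ := dense s (hF s (Finset.mem_insert_self _ _)) Z
      (hZY.trans (hYF s (Finset.mem_insert_self _ _))) hZ
    refine ⟨W, hWZ.trans hZY, hW, fun t ht => ?_⟩
    rcases Finset.mem_insert.1 ht with rfl | ht
    · exact hs
    · exact her _ _ _ hWZ (hΦ t ht)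

/-- A diagonal construction: elements are picked one at a time from shrinking reservoirs, and after
each pick the reservoir is refined to settle the finitely many `s` lying below it. It reduces every
simultaneous thinning below to a single `s`. -/
theorem fusion (Φ : Finset ℕ → Set ℕ → Prop) {M : Set ℕ} (hM : M.Infinite)
    (her : ∀ s Y Z, Z ⊆ Y → Φ s Y → Φ s Z)
    (dense : ∀ s : Finset ℕ, (s : Set ℕ) ⊆ M → ∀ Y ⊆ above s M, Y.Infinite →
      ∃ Z ⊆ Y, Z.Infinite ∧ Φ s Z) :
    ∃ X ⊆ M, X.Infinite ∧ ∀ s : Finset ℕ, (s : Set ℕ) ⊆ X → Φ s (above s X) := by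
  classical
  -- A state is the last chosen element together with a reservoir above it that already satisfies
  -- `Φ` for every admissible `s` bounded by that element.
  let Good : ℕ × Set ℕ → Prop := fun p => p.1 ∈ M ∧ p.2 ⊆ M ∧ p.2.Infinite ∧
    (∀ y ∈ p.2, p.1 < y) ∧
    ∀ s : Finset ℕ, (s : Set ℕ) ⊆ M → s ⊆ Finset.range (p.1 + 1) → Φ s p.2
  have step0 : ∀ x ∈ M, ∀ Y ⊆ M, Y.Infinite → ∃ p : {p // Good p}, p.1.1 = x ∧ p.1.2 ⊆ Y := by
    intro x hx Y hYM hY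
    obtain ⟨Z, hZY, hZ, hΦ⟩ := fusion_finite her dense
      ((Finset.range (x + 1)).powerset.filter fun s => (s : Set ℕ) ⊆ M) {y ∈ Y | x < y}
      (infinite_inter_Ioi hY x) (fun s hs => (Finset.mem_filter.1 hs).2) (fun s hs y hy =>
        ⟨hYM hy.1, fun z hz => lt_of_le_of_lt (Nat.lt_succ_iff.1 (Finset.mem_range.1
          (Finset.mem_powerset.1 (Finset.mem_filter.1 hs).1 hz))) hy.2⟩)
    exact ⟨⟨(x, Z), hx, fun y hy => hYM (hZY hy).1, hZ, fun y hy => (hZY hy).2,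
      fun s hs hs' => hΦ s (Finset.mem_filter.2 ⟨Finset.mem_powerset.2 hs', hs⟩)⟩, rfl,
      fun y hy => (hZY hy).1⟩
  have step : ∀ p : {p // Good p}, ∃ q : {p // Good p}, q.1.1 ∈ p.1.2 ∧ q.1.2 ⊆ p.1.2 := by
    intro p
    obtain ⟨x, hx⟩ := p.2.2.2.1.nonempty
    obtain ⟨q, h1, h2⟩ := step0 x (p.2.2.1 hx) p.1.2 p.2.2.1 p.2.2.2.1
    exact ⟨q, h1 ▸ hx, h2⟩
  choose next hnext using step
  obtain ⟨m, hm⟩ := hM.nonempty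
  obtain ⟨p0, -, -⟩ := step0 m hm M subset_rfl hM
  let a : ℕ → {p // Good p} := fun n => next^[n] p0
  have ha : ∀ n, a (n + 1) = next (a n) := fun n => Function.iterate_succ_apply' _ _ _
  have hanti : Antitone fun n => (a n).1.2 :=
    antitone_nat_of_succ_le fun n => by rw [ha]; exact (hnext _).2
  have hmem : ∀ i j, i < j → (a j).1.1 ∈ (a i).1.2 := by
    intro i j hij
    obtain ⟨j, rfl⟩ : ∃ j', j = j' + 1 := ⟨j - 1, by omega⟩
    have h1 : (a (j + 1)).1.1 ∈ (a j).1.2 := by rw [ha]; exact (hnext _).1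
    exact hanti (Nat.lt_succ_iff.1 hij) h1
  have hmono : StrictMono fun n => (a n).1.1 := fun i j hij => (a i).2.2.2.2.1 _ (hmem i j hij)
  refine ⟨Set.range fun n => (a (n + 1)).1.1, ?_, ?_, fun s hs => ?_⟩
  · rintro _ ⟨n, rfl⟩
    exact (a (n + 1)).2.1
  · exact Set.infinite_range_of_injective fun i j h => by simpa using hmono.injective h
  · have hsM : (s : Set ℕ) ⊆ M := fun x hx => by
      obtain ⟨n, rfl⟩ := hs hx
      exact (a (n + 1)).2.1
    obtain ⟨n, h1, h2⟩ : ∃ n, s ⊆ Finset.range ((a n).1.1 + 1) ∧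
        above s (Set.range fun n => (a (n + 1)).1.1) ⊆ (a n).1.2 := by
      rcases s.eq_empty_or_nonempty with rfl | hne
      · refine ⟨0, by simp, ?_⟩
        rintro _ ⟨⟨n, rfl⟩, -⟩
        exact hmem 0 (n + 1) (Nat.succ_pos n)
      · obtain ⟨n, hn⟩ := hs (s.max'_mem hne)
        refine ⟨n + 1, fun x hx => ?_, ?_⟩
        · have := s.le_max' x hx
          simp only at hn
          rw [Finset.mem_range, hn]
          omega
        · rintro _ ⟨⟨k, rfl⟩, hk⟩
          have := hk _ (s.max'_mem hne)
          rw [← hn] at this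
          exact hmem _ _ (hmono.lt_iff_lt.1 this)
    exact her _ _ _ h2 ((a n).2.2.2.2.2 s hsM h1)

/-! ### Partition theorems -/

/-- Accept/reject argument: on a set where every `s` is decided, rejection of `∅` propagates to all
finite subsets after one more fusion, and no member of `F` can be rejected. -/
theorem galvin (F : Set (Finset ℕ)) {M : Set ℕ} (hM : M.Infinite) :
    ∃ X ⊆ M, X.Infinite ∧ ((∀ s ∈ F, ¬ (s : Set ℕ) ⊆ X) ∨
      ∀ Y ⊆ X, Y.Infinite → ∃ s ∈ F, IsInitSeg s Y) := by
  classical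
  let Acc : Finset ℕ → Set ℕ → Prop := fun s Y =>
    ∀ Z ⊆ Y, Z.Infinite → ∃ t ∈ F, IsInitSeg t ((s : Set ℕ) ∪ Z)
  have hAcc : ∀ s Y Z, Z ⊆ Y → Acc s Y → Acc s Z := fun s Y Z hZY h W hW => h W (hW.trans hZY)
  obtain ⟨X₁, hX₁M, hX₁, h₁⟩ := fusion (fun s Y => Acc s Y ∨ ∀ Z ⊆ Y, Z.Infinite → ¬ Acc s Z) hM
    (fun s Y Z hZY h => h.imp (hAcc _ _ _ hZY) fun h W hW => h W (hW.trans hZY))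
    (fun s _ Y _ hY => by
      by_cases h : ∃ Z ⊆ Y, Z.Infinite ∧ Acc s Z
      · obtain ⟨Z, hZY, hZ, hs⟩ := h
        exact ⟨Z, hZY, hZ, Or.inl hs⟩
      · push Not at h
        exact ⟨Y, subset_rfl, hY, Or.inr h⟩)
  by_cases h0 : Acc ∅ X₁
  · exact ⟨X₁, hX₁M, hX₁, Or.inr fun Y hYX hY => by simpa using h0 Y hYX hY⟩
  obtain ⟨X₂, hX₂, hX₂i, h₂⟩ := fusion (fun s Y => ¬ Acc s (above s X₁) →
      ∀ k ∈ Y, ¬ Acc (insert k s) (above (insert k s) X₁)) hX₁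
    (fun s Y Z hZY h h' k hk => h h' k (hZY hk))
    (fun s hs Y hYX hY => by
      by_cases hacc : Acc s (above s X₁)
      · exact ⟨Y, subset_rfl, hY, fun h => absurd hacc h⟩
      by_cases hK : {k ∈ Y | Acc (insert k s) (above (insert k s) X₁)}.Finite
      · refine ⟨_, Set.sdiff_subset, hY.sdiff hK, fun _ k hk hk' => hk.2 ⟨hk.1, hk'⟩⟩
      -- If infinitely many `k` had `s ∪ {k}` accepted, these `k` would form a set accepting `s`:
      -- any infinite subset begins with one such `k`, and its remaining elements serve as the set
      -- tested by `s ∪ {k}`.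
      · refine absurd ?_ (((h₁ s hs).resolve_left hacc) _
          ((Set.sep_subset _ _).trans hYX) hK)
        intro Z hZK hZ
        have hkZ := Nat.sInf_mem hZ.nonempty
        set k := sInf Z
        obtain ⟨t, ht, hti⟩ := (hZK hkZ).2 (Z \ {k}) (fun x hx => ⟨(hYX (hZK hx.1).1).1, by
          intro y hy
          rcases Finset.mem_insert.1 hy with rfl | hy
          · exact lt_of_le_of_ne (Nat.sInf_le hx.1) (Ne.symm hx.2)
          · exact (hYX (hZK hx.1).1).2 y hy⟩) (hZ.sdiff (Set.finite_singleton k))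
        refine ⟨t, ht, ?_⟩
        convert hti using 1
        ext x
        by_cases hx : x = k
        · simp [hx, hkZ]
        · simp [hx])
  have hrej : ∀ s : Finset ℕ, (s : Set ℕ) ⊆ X₂ → ¬ Acc s (above s X₁) := by
    intro s
    induction s using Finset.induction_on_max with
    | empty => intro _; rwa [above_empty]
    | insert k s hk ih =>
      intro hs
      rw [Finset.coe_insert, Set.insert_subset_iff] at hs
      exact h₂ s hs.2 (ih hs.2) k ⟨hs.1, hk⟩
  refine ⟨X₂, hX₂.trans hX₁M, hX₂i, Or.inl fun s hs hsX => hrej s hsX fun Z hZ _ => ?_⟩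
  exact ⟨s, hs, isInitSeg_union fun x hx => (hZ hx).2⟩

/-- A family of finite sets none of which is a proper initial segment of another. -/
def Thin (B : Set (Finset ℕ)) : Prop :=
  ∀ s ∈ B, ∀ t ∈ B, IsInitSeg s (t : Set ℕ) → s = t

theorem Thin.eq {B : Set (Finset ℕ)} (hB : Thin B) {s t : Finset ℕ} {X : Set ℕ} (hs : s ∈ B)
    (ht : t ∈ B) (hsX : IsInitSeg s X) (htX : IsInitSeg t X) : s = t :=
  (hsX.comparable htX).elim (hB s hs t ht) fun h => (hB t ht s hs h).symm

theorem Thin.mono {B C : Set (Finset ℕ)} (hB : Thin B) (h : C ⊆ B) : Thin C :=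
  fun s hs t ht => hB s (h hs) t (h ht)

/-- Galvin's theorem for the members with property `p`. In its second alternative, thinness forces
the initial segment found in `s ∪ above s X` to be `s` itself. -/
theorem Thin.exists_homogeneous {B : Set (Finset ℕ)} (hB : Thin B) (p : Finset ℕ → Prop)
    {M : Set ℕ} (hM : M.Infinite) : ∃ X ⊆ M, X.Infinite ∧
      ((∀ s ∈ B, (s : Set ℕ) ⊆ X → p s) ∨ ∀ s ∈ B, (s : Set ℕ) ⊆ X → ¬ p s) := by
  obtain ⟨X, hXM, hX, h⟩ := galvin {s ∈ B | p s} hM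
  refine ⟨X, hXM, hX, ?_⟩
  rcases h with h | h
  · exact Or.inr fun s hs hsX hp => h s ⟨hs, hp⟩ hsX
  · refine Or.inl fun s hs hsX => ?_
    obtain ⟨t, ht, hti⟩ := h ((s : Set ℕ) ∪ above s X)
      (Set.union_subset hsX (above_subset _ _)) ((above_infinite s hX).mono Set.subset_union_right)
    rw [hB.eq hs ht.1 (isInitSeg_union_above s X) hti]
    exact ht.2

theorem Thin.exists_monochromatic {B : Set (Finset ℕ)} (hB : Thin B) {ι : Type*}
    (c : Finset ℕ → ι) (F : Finset ι) (hF : F.Nonempty) :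
    ∀ {M : Set ℕ}, M.Infinite → (∀ s ∈ B, (s : Set ℕ) ⊆ M → c s ∈ F) →
      ∃ X ⊆ M, X.Infinite ∧ ∃ i ∈ F, ∀ s ∈ B, (s : Set ℕ) ⊆ X → c s = i := by
  classical
  induction hF using Finset.Nonempty.cons_induction with
  | singleton i =>
    exact fun {M} hM hc => ⟨M, subset_rfl, hM, i, by simp, fun s hs hsM => by
      simpa using hc s hs hsM⟩
  | cons i F hi _ ih =>
    intro M hM hc
    obtain ⟨X, hXM, hX, h | h⟩ := hB.exists_homogeneous (fun s => c s = i) hM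
    · exact ⟨X, hXM, hX, i, by simp, h⟩
    · obtain ⟨Y, hYX, hY, j, hj, hjY⟩ := ih hX fun s hs hsX => by
        have := hc s hs (hsX.trans hXM)
        rw [Finset.mem_cons] at this
        exact this.resolve_left (h s hs hsX)
      exact ⟨Y, hYX.trans hXM, hY, j, Finset.mem_cons_of_mem hj, hjY⟩

/-! ### Fronts and barriers -/

/-- `B` is a front on the infinite set `M`: a thin family of subsets of `M` such that every
infinite subset of `M` has an initial segment in `B`. -/
structure IsFront (B : Set (Finset ℕ)) (M : Set ℕ) : Prop where
  infinite : M.Infinite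
  subset : ∀ s ∈ B, (s : Set ℕ) ⊆ M
  thin : Thin B
  exists_initSeg : ∀ X ⊆ M, X.Infinite → ∃ s ∈ B, IsInitSeg s X

/-- The members of `B` contained in `X`. -/
def restrict (B : Set (Finset ℕ)) (X : Set ℕ) : Set (Finset ℕ) :=
  {s ∈ B | (s : Set ℕ) ⊆ X}

theorem IsFront.restrict {B : Set (Finset ℕ)} {M X : Set ℕ} (hB : IsFront B M) (hXM : X ⊆ M)
    (hX : X.Infinite) : IsFront (restrict B X) X where
  infinite := hX
  subset _ hs := hs.2
  thin := hB.thin.mono (Set.sep_subset _ _)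
  exists_initSeg Y hYX hY := by
    obtain ⟨s, hs, hsY⟩ := hB.exists_initSeg Y (hYX.trans hXM) hY
    exact ⟨s, ⟨hs, hsY.1.trans hYX⟩, hsY⟩

theorem thin_of_isAntichain {B : Set (Finset ℕ)} (hB : IsAntichain (· ⊆ ·) B) : Thin B :=
  fun _ hs _ ht h => by_contra fun hne => hB hs ht hne h.subset

theorem IsFront.isBarrier {B : Set (Finset ℕ)} {M : Set ℕ} (hB : IsFront B M) (h0 : ∅ ∉ B)
    (hanti : IsAntichain (· ⊆ ·) B) : IsBarrier B := by
  have hbase : base B ⊆ M := fun n ⟨s, hs, hn⟩ => hB.subset s hs hn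
  refine ⟨⟨fun hfin => ?_, fun X hX hXB => ?_⟩, hanti⟩
  · have hfin' : (⋃ s ∈ B, (s : Set ℕ)).Finite := hfin.biUnion fun s _ => s.finite_toSet
    obtain ⟨s, hs, hsX⟩ := hB.exists_initSeg _ (Set.sdiff_subset (t := ⋃ s ∈ B, (s : Set ℕ)))
      (hB.infinite.sdiff hfin')
    have hne : s.Nonempty := Finset.nonempty_iff_ne_empty.2 fun h => h0 (h ▸ hs)
    obtain ⟨x, hx⟩ := hne
    exact (hsX.1 hx).2 (Set.mem_biUnion hs hx)
  · obtain ⟨s, hs, hsX⟩ := hB.exists_initSeg X (hXB.trans hbase) hX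
    exact ⟨s, hs, Finset.nonempty_iff_ne_empty.2 fun h => h0 (h ▸ hs), hsX⟩

theorem IsBarrier.empty_notMem {B : Set (Finset ℕ)} (hB : IsBarrier B) : ∅ ∉ B := by
  intro h
  refine hB.1.1 ((Set.finite_singleton (∅ : Finset ℕ)).subset fun s hs => ?_)
  by_contra hne
  exact hB.2 h hs (Ne.symm hne) (Finset.empty_subset s)

theorem IsBarrier.nonempty {B : Set (Finset ℕ)} (hB : IsBarrier B) {s : Finset ℕ} (hs : s ∈ B) :
    s.Nonempty :=
  Finset.nonempty_iff_ne_empty.2 fun h => hB.empty_notMem (h ▸ hs)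

theorem IsBarrier.isFront {B : Set (Finset ℕ)} (hB : IsBarrier B) : IsFront B (base B) where
  infinite hfin := by
    refine hB.1.1 ((hfin.toFinset.powerset.finite_toSet).subset fun s hs => ?_)
    rw [Finset.mem_coe, Finset.mem_powerset]
    exact fun n hn => hfin.mem_toFinset.2 ⟨s, hs, hn⟩
  subset s hs n hn := ⟨s, hs, hn⟩
  thin := thin_of_isAntichain hB.2
  exists_initSeg X hXB hX := by
    obtain ⟨s, hs, -, h⟩ := hB.1.2 X hX hXB
    exact ⟨s, hs, h⟩

theorem IsBarrier.restrict {B : Set (Finset ℕ)} (hB : IsBarrier B) {X : Set ℕ} (hX : X ⊆ base B)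
    (hXi : X.Infinite) : IsBarrier (restrict B X) :=
  (hB.isFront.restrict hX hXi).isBarrier (fun h => hB.empty_notMem h.1)
    (hB.2.subset (Set.sep_subset _ _))

theorem IsFront.exists_isBarrier {B : Set (Finset ℕ)} {M : Set ℕ} (hB : IsFront B M)
    (h0 : ∅ ∉ B) : ∃ X ⊆ M, X.Infinite ∧ IsBarrier (Bqo.restrict B X) := by
  -- The colour is inclusion-minimality in `B`. The negative colour cannot be homogeneous, because a
  -- minimal member of the restriction is minimal in all of `B`.
  obtain ⟨X, hXM, hX, h⟩ := hB.thin.exists_homogeneous (fun s => ∀ t ∈ B, t ⊆ s → t = s)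
    hB.infinite
  refine ⟨X, hXM, hX, (hB.restrict hXM hX).isBarrier (fun h => h0 h.1) ?_⟩
  rcases h with h | h
  · exact fun s hs t ht hne hst => hne (h t ht.1 ht.2 s hs.1 hst)
  · exfalso
    obtain ⟨s₀, hs₀, -⟩ := (hB.restrict hXM hX).exists_initSeg X subset_rfl hX
    obtain ⟨s, hs, hmin⟩ := (wellFounded_lt (α := Finset ℕ)).has_min (Bqo.restrict B X) ⟨s₀, hs₀⟩
    refine h s hs.1 hs.2 fun t ht hts => by_contra fun hne => ?_
    exact hmin t ⟨ht, (Finset.coe_subset.2 hts).trans hs.2⟩ (lt_of_le_of_ne hts hne)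

/-! ### The shift relation -/

theorem mem_tail {r : Finset ℕ} {x : ℕ} : x ∈ tail r ↔ x ∈ r ∧ ∃ y ∈ r, y < x := by
  simp [tail]

theorem tail_insert {n : ℕ} {t : Finset ℕ} (h : ∀ x ∈ t, n < x) : tail (insert n t) = t := by
  ext x
  rw [mem_tail]
  constructor
  · rintro ⟨hx, y, hy, hyx⟩
    rcases Finset.mem_insert.1 hx with rfl | hx
    · rcases Finset.mem_insert.1 hy with rfl | hy
      · exact absurd hyx (lt_irrefl _)
      · exact absurd hyx (h y hy).not_gt
    · exact hx
  · exact fun hx => ⟨Finset.mem_insert_of_mem hx, n, Finset.mem_insert_self _ _, h x hx⟩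

theorem eq_insert_tail {r : Finset ℕ} (hr : r.Nonempty) :
    r = insert (r.min' hr) (tail r) ∧ ∀ x ∈ tail r, r.min' hr < x := by
  have h : ∀ x ∈ tail r, r.min' hr < x := fun x hx => by
    obtain ⟨_, y, hy, hyx⟩ := mem_tail.1 hx
    exact (r.min'_le y hy).trans_lt hyx
  refine ⟨?_, h⟩
  ext x
  rw [Finset.mem_insert, mem_tail]
  constructor
  · intro hx
    rcases eq_or_lt_of_le (r.min'_le x hx) with h | h
    · exact Or.inl h.symm
    · exact Or.inr ⟨hx, _, r.min'_mem hr, h⟩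
  · rintro (rfl | hx)
    · exact r.min'_mem hr
    · exact hx.1

theorem shift_iff {s t : Finset ℕ} : Shift s t ↔ ∃ n, (∀ x ∈ t, n < x) ∧
    IsInitSeg s (insert n t : Finset ℕ) ∧ s ≠ insert n t := by
  constructor
  · rintro ⟨r, hsr, hne, rfl⟩
    have hr : r.Nonempty := by
      rw [Finset.nonempty_iff_ne_empty]
      rintro rfl
      exact hne (Finset.subset_empty.1 hsr.subset)
    obtain ⟨h1, h2⟩ := eq_insert_tail hr
    exact ⟨_, h2, h1 ▸ hsr, h1 ▸ hne⟩
  · rintro ⟨n, hn, h, hne⟩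
    exact ⟨_, h, hne, (tail_insert hn).symm⟩

theorem IsInitSeg.mem_of_nonempty {s t : Finset ℕ} {n : ℕ}
    (h : IsInitSeg s (insert n t : Finset ℕ)) (hs : s.Nonempty) (hn : ∀ x ∈ t, n < x) :
    n ∈ s := by
  obtain ⟨y, hy⟩ := hs
  refine h.2 n (by simp) y hy ?_
  rcases Finset.mem_insert.1 (h.subset hy) with rfl | hy
  · exact le_rfl
  · exact (hn y hy).le

/-! ### The lexicographic order -/

/-- `s` precedes `t` lexicographically because of a first difference `a`, which lies in `s`. -/
def LexAt (s t : Finset ℕ) : Prop :=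
  ∃ a ∈ s, a ∉ t ∧ (∃ b ∈ t, a < b) ∧ ∀ x < a, x ∈ s ↔ x ∈ t

theorem list_lex_of_first_difference {a b : ℕ} : ∀ {l₁ l₂ : List ℕ}, l₁.Pairwise (· < ·) →
    l₂.Pairwise (· < ·) → a ∈ l₁ → a ∉ l₂ → b ∈ l₂ → a < b → (∀ x < a, x ∈ l₁ ↔ x ∈ l₂) →
    List.Lex (· < ·) l₁ l₂
  | [], _, _, _, ha, _, _, _, _ => by simp at ha
  | _ :: _, [], _, _, _, _, hb, _, _ => by simp at hb
  | c :: l₁, d :: l₂, h₁, h₂, ha, ha', hb, hab, h => by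
    rw [List.pairwise_cons] at h₁ h₂
    rcases lt_trichotomy c d with hcd | rfl | hdc
    · exact List.Lex.rel hcd
    · have hac : a ≠ c := by
        rintro rfl
        simp at ha'
      have ha₁ : a ∈ l₁ := (List.mem_cons.1 ha).resolve_left hac
      have hca := h₁.1 a ha₁
      refine List.Lex.cons (list_lex_of_first_difference h₁.2 h₂.2 ha₁
        (fun h' => ha' (List.mem_cons_of_mem _ h')) ?_ hab fun x hx => ?_)
      · refine (List.mem_cons.1 hb).resolve_left ?_
        omega
      · by_cases hxc : x = c
        · subst hxc
          exact ⟨fun h' => absurd (h₁.1 _ h') (lt_irrefl _),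
            fun h' => absurd (h₂.1 _ h') (lt_irrefl _)⟩
        · simpa [hxc] using h x hx
    · exfalso
      have hca : c ≤ a := by
        rcases List.mem_cons.1 ha with rfl | ha
        · exact le_rfl
        · exact (h₁.1 a ha).le
      have hd : d ∈ c :: l₁ := (h d (by omega)).2 (by simp)
      rcases List.mem_cons.1 hd with rfl | hd
      · exact lt_irrefl _ hdc
      · exact lt_asymm hdc (h₁.1 d hd)

theorem list_lex_of_initial : ∀ {l₁ l₂ : List ℕ}, l₁.Pairwise (· < ·) → l₂.Pairwise (· < ·) →
    l₁ ⊆ l₂ → (∀ x ∈ l₂, ∀ y ∈ l₁, x ≤ y → x ∈ l₁) → l₁ ≠ l₂ → List.Lex (· < ·) l₁ l₂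
  | [], [], _, _, _, _, h => absurd rfl h
  | [], _ :: _, _, _, _, _, _ => List.Lex.nil
  | c :: l₁, [], _, _, h, _, _ => by simp at h
  | c :: l₁, d :: l₂, h₁, h₂, hsub, hinit, hne => by
    rw [List.pairwise_cons] at h₁ h₂
    have hdc : d ≤ c := by
      rcases List.mem_cons.1 (hsub (show c ∈ c :: l₁ by simp)) with h | h
      · exact h.ge
      · exact (h₂.1 c h).le
    have hcd : c ≤ d := by
      rcases List.mem_cons.1 (hinit d (by simp) c (by simp) hdc) with h | h
      · exact h.ge
      · exact (h₁.1 d h).le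
    obtain rfl := le_antisymm hcd hdc
    refine List.Lex.cons (list_lex_of_initial h₁.2 h₂.2 (fun x hx => ?_)
      (fun x hx y hy hxy => ?_) fun h => hne (h ▸ rfl))
    · exact (List.mem_cons.1 (hsub (List.mem_cons_of_mem _ hx))).resolve_left (h₁.1 x hx).ne'
    · exact (List.mem_cons.1 (hinit x (List.mem_cons_of_mem _ hx) y
        (List.mem_cons_of_mem _ hy) hxy)).resolve_left (h₂.1 x hx).ne'

theorem LexAt.lexLT {s t : Finset ℕ} (h : LexAt s t) : LexLT s t := by
  obtain ⟨a, ha, ha', ⟨b, hb, hab⟩, h⟩ := h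
  exact list_lex_of_first_difference s.sortedLT_sort.pairwise t.sortedLT_sort.pairwise
    (by simpa using ha) (by simpa using ha') (by simpa using hb) hab (by simpa using h)

theorem IsInitSeg.lexLT {s t : Finset ℕ} (h : IsInitSeg s (t : Set ℕ)) (hne : s ≠ t) :
    LexLT s t := by
  refine list_lex_of_initial s.sortedLT_sort.pairwise t.sortedLT_sort.pairwise
    (fun x hx => ?_) (fun x hx y hy hxy => ?_) fun he => hne ?_
  · simpa using h.subset (by simpa using hx)
  · simpa using h.2 x (by simpa using hx) y (by simpa using hy) hxy
  · rw [← s.sort_toFinset (· ≤ ·), he, t.sort_toFinset]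

theorem LexLT.asymm {s t : Finset ℕ} (h : LexLT s t) : ¬ LexLT t s :=
  fun h' => lt_asymm (α := List ℕ) h h'

theorem lexAt_or {s t : Finset ℕ} (hst : ¬ IsInitSeg s (t : Set ℕ))
    (hts : ¬ IsInitSeg t (s : Set ℕ)) : LexAt s t ∨ LexAt t s := by
  have hne : (symmDiff s t).Nonempty := by
    rw [Finset.nonempty_iff_ne_empty]
    intro h
    rw [← Finset.bot_eq_empty, symmDiff_eq_bot] at h
    exact hst (h ▸ IsInitSeg.refl s)
  have ha := (symmDiff s t).min'_mem hne
  have hmin : ∀ x < (symmDiff s t).min' hne, x ∈ s ↔ x ∈ t := by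
    intro x hx
    by_contra hcon
    refine hx.not_ge (Finset.min'_le _ _ ?_)
    rw [Finset.mem_symmDiff]
    tauto
  set a := (symmDiff s t).min' hne
  rw [Finset.mem_symmDiff] at ha
  rcases ha with ⟨has, hat⟩ | ⟨hat, has⟩
  · refine Or.inl ⟨a, has, hat, ?_, hmin⟩
    by_contra! hcon
    refine hts ⟨fun x hx => (hmin x (lt_of_le_of_ne (hcon x hx) ?_)).2 hx,
      fun x hx y hy hxy => (hmin x (hxy.trans_lt (lt_of_le_of_ne (hcon y hy) ?_))).1 hx⟩
    · rintro rfl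
      exact hat hx
    · rintro rfl
      exact hat hy
  · refine Or.inr ⟨a, hat, has, ?_, fun x hx => (hmin x hx).symm⟩
    by_contra! hcon
    refine hst ⟨fun x hx => (hmin x (lt_of_le_of_ne (hcon x hx) ?_)).1 hx,
      fun x hx y hy hxy => (hmin x (hxy.trans_lt (lt_of_le_of_ne (hcon y hy) ?_))).2 hx⟩
    · rintro rfl
      exact has hx
    · rintro rfl
      exact has hy

theorem Thin.lexAt_or {B : Set (Finset ℕ)} (hB : Thin B) {s t : Finset ℕ} (hs : s ∈ B)
    (ht : t ∈ B) (hne : s ≠ t) : LexAt s t ∨ LexAt t s :=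
  Bqo.lexAt_or (fun h => hne (hB s hs t ht h)) fun h => hne (hB t ht s hs h).symm

theorem Thin.lexAt_of_lexLT {B : Set (Finset ℕ)} (hB : Thin B) {s t : Finset ℕ} (hs : s ∈ B)
    (ht : t ∈ B) (h : LexLT s t) : LexAt s t := by
  refine (hB.lexAt_or hs ht ?_).resolve_right fun h' => h.asymm h'.lexLT
  rintro rfl
  exact h.asymm h

/-- The first difference is followed by a larger element of `t`, so end-extensions cannot disturb
it. Plain `LexLT` lacks this stability when one set is an initial segment of the other. -/
theorem LexAt.extend {s t s' t' : Finset ℕ} (h : LexAt s t) (hs : IsInitSeg s (s' : Set ℕ))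
    (ht : IsInitSeg t (t' : Set ℕ)) : LexAt s' t' := by
  obtain ⟨a, ha, ha', ⟨b, hb, hab⟩, h⟩ := h
  refine ⟨a, hs.subset ha, fun h' => ha' (ht.2 a h' b hb hab.le), ⟨b, ht.subset hb, hab⟩,
    fun x hx => ⟨fun h' => ?_, fun h' => ?_⟩⟩
  · exact ht.subset ((h x hx).1 (hs.2 x h' a ha hx.le))
  · exact hs.subset ((h x hx).2 (ht.2 x h' b hb (hx.trans hab).le))

/-! ### Order types -/

/-- `φ` is strictly increasing along the lexicographic order of `B`, with values below `α`. -/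
def IsLexRank (B : Set (Finset ℕ)) (α : Ordinal.{0}) (φ : Finset ℕ → Ordinal.{0}) : Prop :=
  (∀ s ∈ B, φ s < α) ∧ ∀ s ∈ B, ∀ t ∈ B, LexAt s t → φ s < φ t

theorem OrderTypeLE.exists_isLexRank {B : Set (Finset ℕ)} {α : Ordinal.{0}}
    (h : OrderTypeLE B α) : ∃ φ, IsLexRank B α φ := by
  classical
  obtain ⟨hw, hle⟩ := h
  refine ⟨fun s => if hs : s ∈ B then
    Ordinal.typein (fun s t : B => LexLT s.1 t.1) ⟨s, hs⟩ else 0, fun s hs => ?_,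
    fun s hs t ht hst => ?_⟩
  · simp only [dif_pos hs]
    exact (Ordinal.typein_lt_type _ _).trans_le hle
  · simp only [dif_pos hs, dif_pos ht, Ordinal.typein_lt_typein]
    exact hst.lexLT

theorem IsLexRank.orderTypeLE {B : Set (Finset ℕ)} {α : Ordinal.{0}} {φ : Finset ℕ → Ordinal.{0}}
    (h : IsLexRank B α φ) (hB : Thin B) : OrderTypeLE B α := by
  have hmono : ∀ s t : B, LexLT s.1 t.1 → φ s.1 < φ t.1 := fun s t hst =>
    h.2 s.1 s.2 t.1 t.2 (hB.lexAt_of_lexLT s.2 t.2 hst)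
  have hw : IsWellOrder B (fun s t => LexLT s.1 t.1) :=
    { trichotomous := fun s t h1 h2 => by
        by_contra hne
        rcases hB.lexAt_or s.2 t.2 (fun h => hne (Subtype.ext h)) with h | h
        · exact h1 h.lexLT
        · exact h2 h.lexLT
      wf := Subrelation.wf (fun {s t} hst => hmono s t hst)
        (InvImage.wf (fun s : B => φ s.1) Ordinal.lt_wf) }
  refine ⟨hw, le_of_not_gt fun hlt => ?_⟩
  have hle : ∀ o : Ordinal, ∀ s : B,
      Ordinal.typein (fun s t : B => LexLT s.1 t.1) s = o → o ≤ φ s.1 := by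
    intro o
    induction o using WellFoundedLT.induction with
    | ind o ih =>
      intro s hs
      refine le_of_forall_lt fun o' ho' => ?_
      obtain ⟨t, ht⟩ := Ordinal.typein_surj (fun s t : B => LexLT s.1 t.1)
        ((ho'.trans_eq hs.symm).trans (Ordinal.typein_lt_type _ _))
      refine (ih o' ho' t ht).trans_lt (hmono t s ?_)
      rw [← Ordinal.typein_lt_typein (fun s t : B => LexLT s.1 t.1), ht, hs]
      exact ho'
  obtain ⟨s, hs⟩ := Ordinal.typein_surj (fun s t : B => LexLT s.1 t.1) hlt
  exact (hle _ s hs).not_gt (h.1 s.1 s.2)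

/-- Each member of `C` takes the rank of a chosen end-extension in `B`; first differences survive
the extension, so this is again a rank. -/
theorem OrderTypeLE.of_extension {B C : Set (Finset ℕ)} {α : Ordinal.{0}} (h : OrderTypeLE B α)
    (hC : Thin C) (hext : ∀ s ∈ C, ∃ t ∈ B, IsInitSeg s (t : Set ℕ)) : OrderTypeLE C α := by
  obtain ⟨φ, hφ⟩ := h.exists_isLexRank
  choose! e he using hext
  exact IsLexRank.orderTypeLE (φ := fun s => φ (e s)) ⟨fun s hs => hφ.1 _ (he s hs).1,
    fun s hs t ht hst => hφ.2 _ (he s hs).1 _ (he t ht).1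
      (hst.extend (he s hs).2 (he t ht).2)⟩ hC

theorem OrderTypeLE.subset {B C : Set (Finset ℕ)} {α : Ordinal.{0}} (h : OrderTypeLE B α)
    (hB : Thin B) (hCB : C ⊆ B) : OrderTypeLE C α :=
  h.of_extension (hB.mono hCB) fun s hs => ⟨s, hCB hs, IsInitSeg.refl s⟩

theorem OrderTypeLE.mono {B : Set (Finset ℕ)} {α β : Ordinal.{0}} (h : OrderTypeLE B α)
    (hαβ : α ≤ β) : OrderTypeLE B β :=
  h.imp fun _ h => h.trans hαβ

theorem IsAlphaBqo.mono {Q : Type*} {r : Q → Q → Prop} {α β : Ordinal.{0}}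
    (h : IsAlphaBqo r β) (hαβ : α ≤ β) : IsAlphaBqo r α :=
  fun B hB hBα => h B hB (hBα.mono hαβ)

theorem IsAlphaBqo.comap {Q R : Type*} {r : Q → Q → Prop} {r' : R → R → Prop} {α : Ordinal.{0}}
    (h : IsAlphaBqo r α) (e : R → Q) (he : ∀ x y, r (e x) (e y) → r' x y) : IsAlphaBqo r' α :=
  fun B hB hBα f => by
    obtain ⟨s, t, hst, h⟩ := h B hB hBα (fun s => e (f s))
    exact ⟨s, t, hst, he _ _ h⟩

/-! ### A strictly increasing sum on the ordinals below a power of `ω` -/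

/-- The natural (Hessenberg) sum of ordinals. -/
noncomputable def natAdd (a b : Ordinal.{0}) : Ordinal.{0} :=
  max (⨆ x : Set.Iio a, Order.succ (natAdd x.1 b)) (⨆ x : Set.Iio b, Order.succ (natAdd a x.1))
termination_by (a, b)
decreasing_by all_goals cases x; decreasing_tactic

theorem natAdd_lt_natAdd_left {a a' : Ordinal.{0}} (h : a < a') (b : Ordinal.{0}) :
    natAdd a b < natAdd a' b := by
  rw [natAdd.eq_1 a' b]
  exact (Order.lt_succ _).trans_le ((Ordinal.le_iSup
    (fun x : Set.Iio a' => Order.succ (natAdd x.1 b)) ⟨a, h⟩).trans (le_max_left _ _))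

theorem natAdd_lt_natAdd_right (a : Ordinal.{0}) {b b' : Ordinal.{0}} (h : b < b') :
    natAdd a b < natAdd a b' := by
  rw [natAdd.eq_1 a b']
  exact (Order.lt_succ _).trans_le ((Ordinal.le_iSup
    (fun x : Set.Iio b' => Order.succ (natAdd a x.1)) ⟨b, h⟩).trans (le_max_right _ _))

theorem natAdd_le_natAdd {a a' b b' : Ordinal.{0}} (ha : a ≤ a') (hb : b ≤ b') :
    natAdd a b ≤ natAdd a' b' :=
  ((StrictMono.monotone fun _ _ h => natAdd_lt_natAdd_left h b) ha).trans
    ((StrictMono.monotone fun _ _ h => natAdd_lt_natAdd_right a' h) hb)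

theorem natAdd_le_iff {a b c : Ordinal.{0}} : natAdd a b ≤ c ↔
    (∀ a' < a, natAdd a' b < c) ∧ ∀ b' < b, natAdd a b' < c := by
  rw [natAdd, max_le_iff, Ordinal.iSup_le_iff, Ordinal.iSup_le_iff]
  simp

theorem le_natAdd_left (a b : Ordinal.{0}) : a ≤ natAdd a b :=
  StrictMono.le_apply (f := fun a => natAdd a b) fun _ _ h => natAdd_lt_natAdd_left h b

theorem exists_eq_mul_natCast_add {κ a : Ordinal.{0}} (hκ : 0 < κ) (h : a < κ * ω) :
    ∃ i : ℕ, ∃ a' < κ, a = κ * i + a' := by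
  obtain ⟨i, hi⟩ := Ordinal.lt_omega0.1 ((Ordinal.lt_mul_iff_div_lt hκ.ne').1 h)
  exact ⟨i, a % κ, Ordinal.mod_lt _ hκ.ne', by rw [← hi, Ordinal.div_add_mod]⟩

theorem mul_natCast_add_lt {κ a a' : Ordinal.{0}} {i i' : ℕ} (ha' : a' < κ)
    (h : κ * i + a < κ * i' + a') : i < i' ∨ i = i' ∧ a < a' := by
  rcases lt_trichotomy i i' with hi | rfl | hi
  · exact Or.inl hi
  · exact Or.inr ⟨rfl, lt_of_add_lt_add_left h⟩
  · exfalso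
    refine h.not_ge ?_
    calc κ * i' + a' ≤ κ * i' + κ := by gcongr
      _ = κ * ((i' + 1 : ℕ) : Ordinal.{0}) := by rw [Nat.cast_succ, mul_add, mul_one]
      _ ≤ κ * i := by gcongr; omega
      _ ≤ κ * i + a := le_self_add

theorem mul_natCast_add_lt_of_lt {κ a a' : Ordinal.{0}} {i i' : ℕ} (ha : a < κ) (h : i < i') :
    κ * i + a < κ * i' + a' :=
  calc κ * i + a < κ * i + κ := by gcongr
    _ = κ * ((i + 1 : ℕ) : Ordinal.{0}) := by rw [Nat.cast_succ, mul_add, mul_one]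
    _ ≤ κ * i' := by gcongr; omega
    _ ≤ κ * i' + a' := le_self_add

/-- The successor step of the closure of `ω ^ γ` under `natAdd`: coefficients of `κ` add, and
closure of `κ` keeps the remainders from carrying. -/
theorem natAdd_mul_natCast_add_le {κ : Ordinal.{0}} (hκ : 0 < κ)
    (hadd : ∀ {a b : Ordinal.{0}}, a < κ → b < κ → natAdd a b < κ) (a : Ordinal.{0}) :
    ∀ (b : Ordinal.{0}) {i j : ℕ} {a' b' : Ordinal.{0}}, a' < κ → b' < κ → a = κ * i + a' →
      b = κ * j + b' → natAdd a b ≤ κ * (i + j : ℕ) + natAdd a' b' := by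
  have hlt : ∀ {i : ℕ} {a' c : Ordinal.{0}}, a' < κ → c < κ * i + a' →
      ∃ i₁ : ℕ, ∃ c' < κ, c = κ * i₁ + c' ∧ (i₁ < i ∨ i₁ = i ∧ c' < a') := by
    intro i a' c ha' hc
    have hcω : c < κ * ω := hc.trans <|
      calc κ * i + a' < κ * ((i + 1 : ℕ) : Ordinal.{0}) + 0 :=
            mul_natCast_add_lt_of_lt ha' (Nat.lt_succ_self i)
        _ ≤ κ * ω := by
          rw [add_zero]
          gcongr
          exact (Ordinal.natCast_lt_omega0 _).le
    obtain ⟨i₁, c', hc', rfl⟩ := exists_eq_mul_natCast_add hκ hcω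
    exact ⟨i₁, c', hc', rfl, mul_natCast_add_lt ha' hc⟩
  induction a using WellFoundedLT.induction with
  | ind a iha =>
    intro b
    induction b using WellFoundedLT.induction with
    | ind b ihb =>
      intro i j a' b' ha' hb' ha hb
      rw [natAdd_le_iff]
      constructor
      · intro c hc
        obtain ⟨i₁, c', hc', rfl, h⟩ := hlt ha' (hc.trans_eq ha)
        refine (iha _ hc b hc' hb' rfl hb).trans_lt ?_
        rcases h with h | ⟨rfl, h⟩
        · exact mul_natCast_add_lt_of_lt (hadd hc' hb') (by omega)
        · gcongr
          exact natAdd_lt_natAdd_left h b'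
      · intro c hc
        obtain ⟨i₁, c', hc', rfl, h⟩ := hlt hb' (hc.trans_eq hb)
        refine (ihb _ hc ha' hc' ha rfl).trans_lt ?_
        rcases h with h | ⟨rfl, h⟩
        · exact mul_natCast_add_lt_of_lt (hadd ha' hc') (by omega)
        · gcongr
          exact natAdd_lt_natAdd_right a' h

theorem natAdd_lt_omega0_opow (γ : Ordinal.{0}) :
    ∀ {a b : Ordinal.{0}}, a < ω ^ γ → b < ω ^ γ → natAdd a b < ω ^ γ := by
  induction γ using Ordinal.limitRecOn with
  | zero =>
    intro a b ha hb
    rw [Ordinal.opow_zero, Order.lt_one_iff] at *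
    subst ha hb
    rw [← nonpos_iff_eq_zero, natAdd_le_iff]
    simp
  | add_one γ ih =>
    intro a b ha hb
    rw [Ordinal.opow_add_one] at *
    have hpos : (0 : Ordinal.{0}) < ω ^ γ := Ordinal.opow_pos _ Ordinal.omega0_pos
    obtain ⟨i, a', ha', rfl⟩ := exists_eq_mul_natCast_add hpos ha
    obtain ⟨j, b', hb', rfl⟩ := exists_eq_mul_natCast_add hpos hb
    refine (natAdd_mul_natCast_add_le hpos (fun h h' => ih h h') _ _ ha' hb' rfl rfl).trans_lt ?_
    calc _ < ω ^ γ * ((i + j : ℕ) : Ordinal.{0}) + ω ^ γ := by gcongr; exact ih ha' hb'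
      _ = ω ^ γ * ((i + j + 1 : ℕ) : Ordinal.{0}) := by rw [Nat.cast_succ, mul_add, mul_one]
      _ < ω ^ γ * ω := by
        gcongr
        exact Ordinal.natCast_lt_omega0 _
  | limit γ hγ ih =>
    intro a b ha hb
    rw [Ordinal.lt_opow_of_isSuccLimit Ordinal.omega0_ne_zero hγ] at ha hb
    obtain ⟨c, hc, ha⟩ := ha
    obtain ⟨d, hd, hb⟩ := hb
    have hcd : max c d < γ := max_lt hc hd
    refine (ih _ hcd (ha.trans_le ?_) (hb.trans_le ?_)).trans_le
      (Ordinal.opow_le_opow_right Ordinal.omega0_pos hcd.le)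
    · exact Ordinal.opow_le_opow_right Ordinal.omega0_pos (le_max_left _ _)
    · exact Ordinal.opow_le_opow_right Ordinal.omega0_pos (le_max_right _ _)

/-- The natural sum of `e 0, …, e (k - 1)`, increased by one at each step. -/
noncomputable def natSum (e : ℕ → Ordinal.{0}) : ℕ → Ordinal.{0}
  | 0 => 0
  | k + 1 => Order.succ (natAdd (natSum e k) (e k))

/-- The added successor matters here: a longer sum is larger even if its extra terms vanish. -/
theorem natSum_strictMono (e : ℕ → Ordinal.{0}) : StrictMono (natSum e) :=
  strictMono_nat_of_lt_succ fun _ => Order.lt_succ_of_le (le_natAdd_left _ _)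

theorem natSum_le_natSum {e e' : ℕ → Ordinal.{0}} {k : ℕ} (h : ∀ n < k, e n ≤ e' n) :
    natSum e k ≤ natSum e' k := by
  induction k with
  | zero => exact le_rfl
  | succ k ih =>
    exact Order.succ_le_succ (natAdd_le_natAdd (ih fun n hn => h n (hn.trans (Nat.lt_succ_self k)))
      (h k (Nat.lt_succ_self k)))

theorem natSum_lt_natSum {e e' : ℕ → Ordinal.{0}} {k : ℕ} (h : ∀ n < k, e n ≤ e' n)
    (hlt : ∃ n < k, e n < e' n) : natSum e k < natSum e' k := by
  induction k with
  | zero => simp at hlt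
  | succ k ih =>
    have h' : ∀ n < k, e n ≤ e' n := fun n hn => h n (hn.trans (Nat.lt_succ_self k))
    refine Order.succ_lt_succ ?_
    obtain ⟨n, hn, hlt⟩ := hlt
    rcases Nat.lt_succ_iff_lt_or_eq.1 hn with hn | rfl
    · exact (natAdd_lt_natAdd_left (ih h' ⟨n, hn, hlt⟩) _).trans_le
        (natAdd_le_natAdd le_rfl (h k (Nat.lt_succ_self k)))
    · exact (natAdd_lt_natAdd_right _ hlt).trans_le (natAdd_le_natAdd (natSum_le_natSum h') le_rfl)

theorem natSum_lt_omega0_opow {γ : Ordinal.{0}} (hγ : γ ≠ 0) {e : ℕ → Ordinal.{0}} {k : ℕ}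
    (h : ∀ n < k, e n < ω ^ γ) : natSum e k < ω ^ γ := by
  induction k with
  | zero => exact Ordinal.opow_pos _ Ordinal.omega0_pos
  | succ k ih =>
    refine (Ordinal.isSuccLimit_opow_left Ordinal.isSuccLimit_omega0 hγ).succ_lt ?_
    exact natAdd_lt_omega0_opow γ (ih fun n hn => h n (hn.trans (Nat.lt_succ_self k)))
      (h k (Nat.lt_succ_self k))

/-! ### Bad maps on barriers -/

theorem IsBarrier.isInitSeg_insert {B : Set (Finset ℕ)} (hB : IsBarrier B) {s t : Finset ℕ}
    {n : ℕ} {Y : Set ℕ} (hn : ∀ x ∈ Y, n < x) (hs : s ∈ B) (ht : t ∈ B)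
    (hsY : IsInitSeg s (insert n Y)) (htY : IsInitSeg t Y) :
    IsInitSeg s (insert n t : Finset ℕ) ∧ s ≠ insert n t := by
  -- Otherwise `t ⊆ s`, so `t = s` by the antichain property, although `n` lies in `s` and below all
  -- of `t`.
  have key : ¬ insert n t ⊆ s := fun h => by
    have hts : t = s := by
      by_contra hne
      exact hB.2 ht hs hne ((Finset.subset_insert n t).trans h)
    exact lt_irrefl n (hn n (htY.1 (hts ▸ h (Finset.mem_insert_self n t))))
  refine ⟨(hsY.comparable (htY.insert_lt hn)).resolve_right fun h => key h.subset, ?_⟩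
  rintro rfl
  exact key subset_rfl

theorem IsBarrier.shift {B : Set (Finset ℕ)} (hB : IsBarrier B) {s t : Finset ℕ}
    {n : ℕ} {Y : Set ℕ} (hn : ∀ x ∈ Y, n < x) (hs : s ∈ B) (ht : t ∈ B)
    (hsY : IsInitSeg s (insert n Y)) (htY : IsInitSeg t Y) : Shift s t :=
  shift_iff.2 ⟨n, fun x hx => hn x (htY.1 hx), hB.isInitSeg_insert hn hs ht hsY htY⟩

theorem exists_eq_insert {X : Set ℕ} (hX : X.Nonempty) :
    X = insert (sInf X) (X \ {sInf X}) ∧ ∀ x ∈ X \ {sInf X}, sInf X < x :=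
  ⟨by rw [Set.insert_sdiff_singleton, Set.insert_eq_of_mem (Nat.sInf_mem hX)],
    fun _ hx => lt_of_le_of_ne (Nat.sInf_le hx.1) (Ne.symm hx.2)⟩

theorem IsBarrier.exists_shift_of_mem {B : Set (Finset ℕ)} (hB : IsBarrier B) {X : Set ℕ}
    (hX : X.Infinite) (hXB : X ⊆ base B) {s : Finset ℕ} (hs : s ∈ B) (hsX : (s : Set ℕ) ⊆ X) :
    ∃ t ∈ B, (t : Set ℕ) ⊆ X ∧ Shift s t := by
  set Z := (s : Set ℕ) ∪ above s X
  have hZX : Z ⊆ X := Set.union_subset hsX (above_subset s X)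
  have hZ : Z.Infinite := (above_infinite s hX).mono Set.subset_union_right
  obtain ⟨h1, h2⟩ := exists_eq_insert hZ.nonempty
  obtain ⟨t, ht, htZ⟩ := hB.isFront.exists_initSeg (Z \ {sInf Z})
    ((Set.sdiff_subset.trans hZX).trans hXB) (hZ.sdiff (Set.finite_singleton _))
  exact ⟨t, ht, htZ.1.trans (Set.sdiff_subset.trans hZX),
    hB.shift h2 hs ht (h1 ▸ isInitSeg_union_above s X) htZ⟩

theorem IsBarrier.exists_shift {B : Set (Finset ℕ)} (hB : IsBarrier B) {X : Set ℕ}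
    (hX : X.Infinite) (hXB : X ⊆ base B) :
    ∃ s ∈ B, ∃ t ∈ B, (s : Set ℕ) ⊆ X ∧ (t : Set ℕ) ⊆ X ∧ Shift s t := by
  obtain ⟨s, hs, hsX⟩ := hB.isFront.exists_initSeg X hXB hX
  obtain ⟨t, ht, htX, hst⟩ := hB.exists_shift_of_mem hX hXB hs hsX.1
  exact ⟨s, hs, t, ht, hsX.1, htX, hst⟩

/-- `f` is bad on `B` for the relation `r`. -/
def IsBad {Q : Type*} (r : Q → Q → Prop) (B : Set (Finset ℕ)) (f : Finset ℕ → Q) : Prop :=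
  ∀ s ∈ B, ∀ t ∈ B, Shift s t → ¬ r (f s) (f t)

theorem isAlphaBqo_iff {Q : Type*} {r : Q → Q → Prop} {α : Ordinal.{0}} :
    IsAlphaBqo r α ↔ ∀ B, IsBarrier B → OrderTypeLE B α → ∀ f, ¬ IsBad r B f := by
  classical
  constructor
  · intro h B hB hBα f hf
    obtain ⟨s, t, hst, hr⟩ := h B hB hBα (fun s => f s.1)
    exact hf s.1 s.2 t.1 t.2 hst hr
  · intro h B hB hBα f
    by_contra hbad
    obtain ⟨s₀, hs₀⟩ := hB.1.1.nonempty
    refine h B hB hBα (fun s => if hs : s ∈ B then f ⟨s, hs⟩ else f ⟨s₀, hs₀⟩) ?_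
    intro s hs t ht hst hr
    simp only [dif_pos hs, dif_pos ht] at hr
    exact hbad ⟨⟨s, hs⟩, ⟨t, ht⟩, hst, hr⟩

theorem sInf_insert {n : ℕ} {t : Finset ℕ} (h : ∀ x ∈ t, n < x) :
    sInf ((insert n t : Finset ℕ) : Set ℕ) = n := by
  refine le_antisymm (Nat.sInf_le (by simp)) (le_csInf ⟨n, by simp⟩ fun x hx => ?_)
  rcases Finset.mem_insert.1 (Finset.mem_coe.1 hx) with rfl | hx
  · exact le_rfl
  · exact (h x hx).le

theorem lexAt_insert_cases {m m' : ℕ} {t t' : Finset ℕ} (hm : ∀ x ∈ t, m < x)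
    (hm' : ∀ x ∈ t', m' < x) (h : LexAt (insert m t) (insert m' t')) :
    m < m' ∨ m = m' ∧ LexAt t t' := by
  obtain ⟨a, ha, ha', ⟨b, hb, hab⟩, h⟩ := h
  rcases Finset.mem_insert.1 ha with rfl | hat
  · left
    by_contra! hle
    have hne : m' ≠ a := fun h => ha' (h ▸ Finset.mem_insert_self _ _)
    have hlt := lt_of_le_of_ne hle hne
    rcases Finset.mem_insert.1 ((h m' hlt).2 (Finset.mem_insert_self _ _)) with h' | h'
    · exact hne h'
    · exact lt_asymm hlt (hm m' h')
  · right
    have hma := hm a hat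
    have hmm : m = m' := by
      rcases Finset.mem_insert.1 ((h m hma).1 (Finset.mem_insert_self _ _)) with h' | h'
      · exact h'
      · have hlt := hm' m h'
        rcases Finset.mem_insert.1 ((h m' (hlt.trans hma)).2 (Finset.mem_insert_self _ _)) with
          h'' | h''
        · exact h''.symm
        · exact absurd hlt (hm m' h'').not_gt
    subst hmm
    refine ⟨rfl, a, hat, fun h' => ha' (Finset.mem_insert_of_mem h'), ⟨b, ?_, hab⟩,
      fun x hx => ?_⟩
    · exact (Finset.mem_insert.1 hb).resolve_left (hma.trans hab).ne'
    · have := h x hx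
      by_cases hxm : x = m
      · subst hxm
        exact ⟨fun h' => absurd (hm x h') (lt_irrefl _), fun h' => absurd (hm' x h') (lt_irrefl _)⟩
      · simpa [hxm] using this

/-! ### From `P` to its power set -/

/-- The family of the unions `s ∪ t` for `s ◁ t` in `B`. -/
def square (B : Set (Finset ℕ)) : Set (Finset ℕ) :=
  {r | tail r ∈ B ∧ ∃ s ∈ B, IsInitSeg s (r : Set ℕ) ∧ s ≠ r}

theorem IsBarrier.nonempty_of_mem_square {B : Set (Finset ℕ)} (hB : IsBarrier B) {r : Finset ℕ}
    (hr : r ∈ square B) : r.Nonempty := by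
  obtain ⟨-, s, hs, hsr, -⟩ := hr
  exact (hB.nonempty hs).mono hsr.subset

theorem IsBarrier.square {B : Set (Finset ℕ)} (hB : IsBarrier B) : IsBarrier (square B) := by
  have hanti : IsAntichain (· ⊆ ·) (Bqo.square B) := by
    intro r hr r' hr' hne hsub
    obtain ⟨h1, h2⟩ := eq_insert_tail (hB.nonempty_of_mem_square hr)
    obtain ⟨h1', h2'⟩ := eq_insert_tail (hB.nonempty_of_mem_square hr')
    set m := r.min' (hB.nonempty_of_mem_square hr)
    set m' := r'.min' (hB.nonempty_of_mem_square hr')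
    have hmr : m ∈ r := Finset.min'_mem _ _
    have hm'm : m' ≤ m := Finset.min'_le _ _ (hsub hmr)
    have htt : tail r ⊆ tail r' := fun x hx => by
      have hx' : x ∈ r' := hsub (mem_tail.1 hx).1
      rw [h1'] at hx'
      exact (Finset.mem_insert.1 hx').resolve_left (hm'm.trans_lt (h2 x hx)).ne'
    have heq : tail r = tail r' := by
      by_contra hne'
      exact hB.2 hr.1 hr'.1 hne' htt
    have hmm : m = m' := by
      have hx' := hsub hmr
      rw [h1'] at hx'
      refine (Finset.mem_insert.1 hx').resolve_right fun h => ?_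
      exact lt_irrefl _ (h2 m (heq ▸ h))
    refine hne (h1.trans (Eq.trans ?_ h1'.symm))
    rw [heq, hmm]
  refine IsFront.isBarrier (M := base B) ⟨hB.isFront.infinite, fun r hr => ?_,
    thin_of_isAntichain hanti, fun X hXB hX => ?_⟩ (fun h => ?_) hanti
  · have hne := hB.nonempty_of_mem_square hr
    obtain ⟨h1, h2⟩ := eq_insert_tail hne
    obtain ⟨ht, s, hs, hsr, -⟩ := hr
    have hsr' : IsInitSeg s (insert (r.min' hne) (tail r) : Finset ℕ) := by rwa [← h1]
    have hm := hsr'.mem_of_nonempty (hB.nonempty hs) h2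
    rw [h1, Finset.coe_insert, Set.insert_subset_iff]
    exact ⟨⟨s, hs, hm⟩, hB.isFront.subset _ ht⟩
  · obtain ⟨h1, h2⟩ := exists_eq_insert hX.nonempty
    obtain ⟨s, hs, hsX⟩ := hB.isFront.exists_initSeg X hXB hX
    obtain ⟨t, ht, htX⟩ := hB.isFront.exists_initSeg (X \ {sInf X}) (Set.sdiff_subset.trans hXB)
      (hX.sdiff (Set.finite_singleton _))
    obtain ⟨h3, h4⟩ := hB.isInitSeg_insert h2 hs ht (h1 ▸ hsX) htX
    refine ⟨insert (sInf X) t, ⟨?_, s, hs, h3, h4⟩, ?_⟩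
    · rwa [tail_insert fun x hx => h2 x (htX.1 hx)]
    · have := htX.insert_lt h2
      rwa [← h1] at this
  · exact Finset.not_nonempty_empty (hB.nonempty_of_mem_square h)

/-- The least element is compared first and the tail second, which is the order of `α * n + φ (tail
r)`. -/
theorem IsBarrier.orderTypeLE_square {B : Set (Finset ℕ)} (hB : IsBarrier B) {α : Ordinal.{0}}
    (h : OrderTypeLE B α) : OrderTypeLE (Bqo.square B) (α * ω) := by
  obtain ⟨φ, hφ⟩ := h.exists_isLexRank
  refine IsLexRank.orderTypeLE
    (φ := fun r => α * (sInf (r : Set ℕ) : ℕ) + φ (tail r)) ⟨fun r hr => ?_,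
      fun r hr r' hr' h => ?_⟩ (thin_of_isAntichain hB.square.2)
  · calc α * (sInf (r : Set ℕ) : ℕ) + φ (tail r)
        < α * ((sInf (r : Set ℕ) + 1 : ℕ) : Ordinal.{0}) + 0 :=
          mul_natCast_add_lt_of_lt (hφ.1 _ hr.1) (Nat.lt_succ_self _)
      _ ≤ α * ω := by
        rw [add_zero]
        gcongr
        exact (Ordinal.natCast_lt_omega0 _).le
  · obtain ⟨h1, h2⟩ := eq_insert_tail (hB.nonempty_of_mem_square hr)
    obtain ⟨h1', h2'⟩ := eq_insert_tail (hB.nonempty_of_mem_square hr')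
    have e := sInf_insert h2
    have e' := sInf_insert h2'
    rw [← h1] at e
    rw [← h1'] at e'
    simp only [e, e']
    rw [h1, h1'] at h
    rcases lexAt_insert_cases h2 h2' h with h | ⟨h, h'⟩
    · exact mul_natCast_add_lt_of_lt (hφ.1 _ hr.1) h
    · rw [h]
      gcongr
      exact hφ.2 _ hr.1 _ hr'.1 h'

theorem isAlphaBqo_dom {P : Type*} [Preorder P] {α : Ordinal.{0}}
    (h : IsAlphaBqo (fun x y : P => x ≤ y) (α * ω)) : IsAlphaBqo (@Dom P _) α := by
  rw [isAlphaBqo_iff] at h ⊢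
  intro B hB hBα F hF
  have hg : ∀ r : Finset ℕ, ∃ x : P, r ∈ square B →
      ∃ s ∈ B, IsInitSeg s (r : Set ℕ) ∧ x ∈ F s ∧ ∀ y ∈ F (tail r), ¬ x ≤ y := by
    intro r
    have key : ∀ r ∈ square B, ∃ x : P,
        ∃ s ∈ B, IsInitSeg s (r : Set ℕ) ∧ x ∈ F s ∧ ∀ y ∈ F (tail r), ¬ x ≤ y := by
      rintro r ⟨ht, s, hs, hsr, hne⟩
      have := hF s hs _ ht ⟨r, hsr, hne, rfl⟩
      simp only [Dom] at this
      push Not at this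
      obtain ⟨x, hx, hxy⟩ := this
      exact ⟨x, s, hs, hsr, hx, hxy⟩
    by_cases hr : r ∈ square B
    · obtain ⟨x, hx⟩ := key r hr
      exact ⟨x, fun _ => hx⟩
    · obtain ⟨r', hr'⟩ := hB.square.1.1.nonempty
      obtain ⟨x, -⟩ := key r' hr'
      exact ⟨x, fun h => absurd h hr⟩
  choose g hg using hg
  refine h _ hB.square (hB.orderTypeLE_square hBα) g fun r hr r' hr' hrr' hle => ?_
  obtain ⟨s, -, -, -, hs⟩ := hg r hr
  obtain ⟨s', hs', hs'r', hx, -⟩ := hg r' hr'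
  obtain ⟨n, hn, hrn, hne⟩ := shift_iff.1 hrr'
  have hnr := hrn.mem_of_nonempty (hB.nonempty_of_mem_square hr) hn
  -- From `r ◁ r'` the tail of `r` begins `r'`, so by thinness it is the member of `B` from which
  -- the witness at `r'` was taken. That witness lies in `F (tail r)`, which the witness at `r`
  -- avoids.
  have htr : IsInitSeg (tail r) (r' : Set ℕ) := by
    constructor
    · intro x hx
      obtain ⟨hx, y, hy, hyx⟩ := mem_tail.1 hx
      refine (Finset.mem_insert.1 (hrn.subset hx)).resolve_left ?_
      rintro rfl
      rcases Finset.mem_insert.1 (hrn.subset hy) with rfl | hy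
      · exact lt_irrefl _ hyx
      · exact lt_asymm hyx (hn y hy)
    · intro x hx y hy hxy
      refine mem_tail.2 ⟨hrn.2 x (by simp [Finset.mem_coe.1 hx]) y (mem_tail.1 hy).1 hxy, n, hnr,
        hn x hx⟩
  have := hB.isFront.thin.eq hs' hr.1 hs'r' htr
  exact hs _ (this ▸ hx) hle

/-! ### Singletons -/

theorem wellQuasiOrderedLE_of_isAlphaBqo {P : Type*} [Preorder P]
    (h : IsAlphaBqo (fun x y : P => x ≤ y) ω) : WellQuasiOrderedLE P := by
  refine ⟨fun f => ?_⟩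
  have hanti : IsAntichain (· ⊆ ·) (Set.range fun n : ℕ => ({n} : Finset ℕ)) := by
    rintro _ ⟨m, rfl⟩ _ ⟨n, rfl⟩ hne hsub
    simp only [Finset.singleton_subset_singleton] at hsub
    exact hne (by rw [hsub])
  have hB : IsBarrier (Set.range fun n : ℕ => ({n} : Finset ℕ)) := by
    refine IsFront.isBarrier (M := Set.univ) ⟨Set.infinite_univ, fun _ _ => Set.subset_univ _,
      thin_of_isAntichain hanti, fun X _ hX => ⟨_, ⟨sInf X, rfl⟩, ?_, ?_⟩⟩ (by simp) hanti
    · simpa using Nat.sInf_mem hX.nonempty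
    · intro x hx y hy hxy
      rw [Finset.mem_singleton] at hy ⊢
      exact le_antisymm (hxy.trans hy.le) (Nat.sInf_le hx)
  have hrank : IsLexRank (Set.range fun n : ℕ => ({n} : Finset ℕ)) ω
      (fun s => ((s.sup id : ℕ) : Ordinal.{0})) := by
    refine ⟨fun s _ => Ordinal.natCast_lt_omega0 _, ?_⟩
    rintro _ ⟨m, rfl⟩ _ ⟨n, rfl⟩ ⟨a, ha, -, ⟨b, hb, hab⟩, -⟩
    rw [Finset.mem_singleton] at ha hb
    subst ha hb
    simpa using hab
  obtain ⟨⟨_, m, rfl⟩, ⟨_, n, rfl⟩, hst, hle⟩ :=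
    h _ hB (hrank.orderTypeLE hB.isFront.thin) (fun s => f (s.1.sup id))
  refine ⟨m, n, ?_, by simpa using hle⟩
  obtain ⟨k, hk, h1, -⟩ := shift_iff.1 hst
  have := h1.mem_of_nonempty (by simp) hk
  rw [Finset.mem_singleton] at this
  subst this
  exact hk n (by simp)

/-! ### From increasing sequences to elements -/

theorem Thin.isInitSeg_of_extension {B : Set (Finset ℕ)} (hB : Thin B) {s t u : Finset ℕ}
    {Z : Set ℕ} (ht : t ∈ B) (hu : u ∈ B) (hsu : IsInitSeg s (u : Set ℕ)) (hs : IsInitSeg s Z)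
    (htZ : IsInitSeg t Z) : IsInitSeg s (t : Set ℕ) := by
  rcases hs.comparable htZ with h | h
  · exact h
  · rwa [hB t ht u hu (h.trans hsu)]

theorem IsInitSeg.subset_union_above {s t : Finset ℕ} {X : Set ℕ} (h : IsInitSeg s (t : Set ℕ))
    (ht : (t : Set ℕ) ⊆ X) : (t : Set ℕ) ⊆ (s : Set ℕ) ∪ above s X := fun x hx => by
  by_cases hxs : x ∈ s
  · exact Or.inl hxs
  · exact Or.inr ⟨ht hx, h.lt_of_notMem hx hxs⟩

theorem isInitSeg_insert_self {s : Finset ℕ} {k : ℕ} (h : ∀ y ∈ s, y < k) :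
    IsInitSeg s (insert k s : Finset ℕ) := by
  refine ⟨by simp, fun x hx y hy hxy => ?_⟩
  rcases Finset.mem_insert.1 (Finset.mem_coe.1 hx) with rfl | hx
  · exact absurd (h y hy) hxy.not_gt
  · exact hx

/-- A bad map on a barrier factors, on an infinite set, through a front on which it depends
on the last element of its argument. -/
theorem exists_front_nonconstant {P : Type*} [Preorder P] {B : Set (Finset ℕ)}
    (hB : IsBarrier B) {f : Finset ℕ → P} (hf : IsBad (· ≤ ·) B f) :
    ∃ (C : Set (Finset ℕ)) (X : Set ℕ) (g : Finset ℕ → P), IsFront C X ∧ ∅ ∉ C ∧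
      (∀ s ∈ C, ∃ t ∈ B, IsInitSeg s (t : Set ℕ)) ∧ IsBad (· ≤ ·) C g ∧
      ∀ s : Finset ℕ, (s : Set ℕ) ⊆ X → ∀ Y ⊆ above s X, Y.Infinite → ∀ c,
        ¬ ∀ k ∈ Y, insert k s ∈ C ∧ g (insert k s) = c := by
  classical
  let Const : Finset ℕ → Set ℕ → Prop := fun s Y => ∀ t ∈ B, ∀ t' ∈ B, IsInitSeg s (t : Set ℕ) →
    IsInitSeg s (t' : Set ℕ) → (t : Set ℕ) ⊆ (s : Set ℕ) ∪ Y → (t' : Set ℕ) ⊆ (s : Set ℕ) ∪ Y →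
    f t = f t'
  have hConst : ∀ s Y Z, Z ⊆ Y → Const s Y → Const s Z := fun s Y Z hZY h t ht t' ht' hs hs' h1 h2 =>
    h t ht t' ht' hs hs' (h1.trans (Set.union_subset_union_right _ hZY))
      (h2.trans (Set.union_subset_union_right _ hZY))
  obtain ⟨X, hXB, hX, hdec⟩ := fusion
    (fun s Y => Const s Y ∨ ∀ Z ⊆ Y, Z.Infinite → ¬ Const s Z) hB.isFront.infinite
    (fun s Y Z hZY h => h.imp (hConst _ _ _ hZY) fun h W hW => h W (hW.trans hZY))
    (fun s _ Y _ hY => by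
      by_cases h : ∃ Z ⊆ Y, Z.Infinite ∧ Const s Z
      · obtain ⟨Z, hZY, hZ, hs⟩ := h
        exact ⟨Z, hZY, hZ, Or.inl hs⟩
      · push Not at h
        exact ⟨Y, subset_rfl, hY, Or.inr h⟩)
  -- The shortest initial segments that already determine the value of `f` inside `X`.
  let C : Set (Finset ℕ) := {s | (s : Set ℕ) ⊆ X ∧ (∃ t ∈ B, IsInitSeg s (t : Set ℕ)) ∧
    Const s (above s X) ∧ ∀ u, IsInitSeg u (s : Set ℕ) → Const u (above u X) → u = s}
  have hext : ∀ s ∈ C, ∃ t ∈ B, IsInitSeg s (t : Set ℕ) ∧ (t : Set ℕ) ⊆ X := by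
    rintro s ⟨hsX, ⟨u, hu, hsu⟩, -⟩
    have hZX : (s : Set ℕ) ∪ above s X ⊆ X := Set.union_subset hsX (above_subset s X)
    obtain ⟨t, ht, htZ⟩ := hB.isFront.exists_initSeg _ (hZX.trans hXB)
      ((above_infinite s hX).mono Set.subset_union_right)
    exact ⟨t, ht, hB.isFront.thin.isInitSeg_of_extension ht hu hsu (isInitSeg_union_above s X) htZ,
      htZ.1.trans hZX⟩
  choose! e he using hext
  have hfe : ∀ s ∈ C, ∀ t ∈ B, IsInitSeg s (t : Set ℕ) → (t : Set ℕ) ⊆ X → f t = f (e s) :=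
    fun s hs t ht hst htX => hs.2.2.1 t ht _ (he s hs).1 hst (he s hs).2.1
      (hst.subset_union_above htX) ((he s hs).2.1.subset_union_above (he s hs).2.2)
  have h0 : ∅ ∉ C := by
    intro h
    obtain ⟨s, hs, t, ht, hsX, htX, hst⟩ := hB.exists_shift hX hXB
    have hempty : ∀ u : Finset ℕ, IsInitSeg ∅ (u : Set ℕ) := fun u => ⟨by simp, by simp⟩
    refine hf s hs t ht hst (le_of_eq ?_)
    rw [hfe _ h s hs (hempty s) hsX, hfe _ h t ht (hempty t) htX]
  refine ⟨C, X, fun s => f (e s), ⟨hX, fun s hs => hs.1, fun s hs t ht hst => ?_,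
    fun Y hYX hY => ?_⟩, h0, fun s hs => hs.2.1, fun s hs s' hs' hss' hle => ?_,
    fun s hsX Y hYs hY c hc => ?_⟩
  · exact ht.2.2.2 s hst hs.2.2.1
  · obtain ⟨t, ht, htY⟩ := hB.isFront.exists_initSeg Y (hYX.trans hXB) hY
    have htc : Const t (above t X) := fun u hu u' hu' h h' _ _ => by
      rw [← hB.isFront.thin t ht u hu h, ← hB.isFront.thin t ht u' hu' h']
    obtain ⟨s, ⟨hst, hsc⟩, hmin⟩ := (wellFounded_lt (α := Finset ℕ)).has_min
      {s | IsInitSeg s (t : Set ℕ) ∧ Const s (above s X)} ⟨t, IsInitSeg.refl t, htc⟩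
    refine ⟨s, ⟨hst.1.trans (htY.1.trans hYX), ⟨t, ht, hst⟩, hsc, fun u hu huc => ?_⟩,
      hst.trans htY⟩
    by_contra hne
    exact hmin u ⟨hu.trans hst, huc⟩ (lt_of_le_of_ne hu.subset hne)
  · obtain ⟨n, hn, hsn, -⟩ := shift_iff.1 hss'
    have hns : n ∈ s := hsn.mem_of_nonempty
      (Finset.nonempty_iff_ne_empty.2 fun h => h0 (h ▸ hs)) hn
    have hY : (above s' X).Infinite := above_infinite s' hX
    obtain ⟨k, hk⟩ : s'.Nonempty := Finset.nonempty_iff_ne_empty.2 fun h => h0 (h ▸ hs')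
    -- The pair `s ◁ s'` is prolonged to a pair in `B` along `{n} ∪ s' ∪ above s' X`; the
    -- prolongations have the same values, so badness of `f` passes to the front.
    have hnZ : ∀ x ∈ (s' : Set ℕ) ∪ above s' X, n < x := by
      rintro x (hx | hx)
      · exact hn x hx
      · exact (hn k hk).trans (hx.2 k hk)
    have hZX : (s' : Set ℕ) ∪ above s' X ⊆ X := Set.union_subset hs'.1 (above_subset s' X)
    have hZX' : insert n ((s' : Set ℕ) ∪ above s' X) ⊆ X :=
      Set.insert_subset (hs.1 hns) hZX
    have hZ : ((s' : Set ℕ) ∪ above s' X).Infinite := hY.mono Set.subset_union_right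
    obtain ⟨t, ht, htZ⟩ := hB.isFront.exists_initSeg _ (hZX'.trans hXB)
      (hZ.mono (Set.subset_insert _ _))
    obtain ⟨t', ht', ht'Z⟩ := hB.isFront.exists_initSeg _ (hZX.trans hXB) hZ
    have hsZ := hsn.trans ((isInitSeg_union_above s' X).insert_lt hnZ)
    have hst := hB.isFront.thin.isInitSeg_of_extension ht (he s hs).1 (he s hs).2.1 hsZ htZ
    have hst' := hB.isFront.thin.isInitSeg_of_extension ht' (he s' hs').1 (he s' hs').2.1
      (isInitSeg_union_above s' X) ht'Z
    refine hf t ht t' ht' (hB.shift hnZ ht ht' htZ ht'Z) ?_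
    rw [hfe s hs t ht hst (htZ.1.trans hZX'), hfe s' hs' t' ht' hst' (ht'Z.1.trans hZX)]
    exact hle
  -- A common value on one-point extensions would make `f` constant above `s` itself, contradicting
  -- the minimality of `s ∪ {k}` in `C`.
  · have hsc : Const s Y := by
      have key : ∀ t ∈ B, IsInitSeg s (t : Set ℕ) → (t : Set ℕ) ⊆ (s : Set ℕ) ∪ Y → f t = c := by
        intro t ht hst htY
        have hne : s ≠ t := by
          rintro rfl
          obtain ⟨k, hk⟩ := hY.nonempty
          have hks := isInitSeg_insert_self (hYs hk).2
          have h := he _ (hc k hk).1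
          have heq := hB.isFront.thin s ht _ h.1 (hks.trans h.2.1)
          exact lt_irrefl k ((hYs hk).2 k (heq ▸ h.2.1.subset (Finset.mem_insert_self k s)))
        obtain ⟨k, hkt, hks, hins⟩ := hst.insert_next (IsInitSeg.refl t) hst hne
        have hkY : k ∈ Y := (htY hkt).resolve_left hks
        rw [← (hc k hkY).2]
        exact hfe _ (hc k hkY).1 t ht hins (htY.trans
          (Set.union_subset hsX (hYs.trans (above_subset s X))))
      intro t ht t' ht' hst hst' htY ht'Y
      rw [key t ht hst htY, key t' ht' hst' ht'Y]
    have hsc' := (hdec s hsX).resolve_right fun h => h Y hYs hY hsc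
    obtain ⟨k, hk⟩ := hY.nonempty
    have heq := (hc k hk).1.2.2.2 s (isInitSeg_insert_self (hYs hk).2) hsc'
    exact lt_irrefl k ((hYs hk).2 k (heq ▸ Finset.mem_insert_self k s))

/-- Wqo gives a monotone subsequence; Ramsey for `<` then makes it strictly increasing or constant,
and the latter is excluded. -/
theorem exists_strictMono_of_not_constant {P : Type*} [PartialOrder P] [WellQuasiOrderedLE P]
    {g : ℕ → P} {K : Set ℕ} (hK : K.Infinite)
    (hg : ∀ Y ⊆ K, Y.Infinite → ∀ c, ¬ ∀ k ∈ Y, g k = c) :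
    ∃ Y ⊆ K, Y.Infinite ∧ ∀ k ∈ Y, ∀ l ∈ Y, k < l → g k < g l := by
  have hnth : StrictMono (Nat.nth (· ∈ K)) := Nat.nth_strictMono hK
  obtain ⟨h, hh⟩ := (wellQuasiOrdered_le (α := P)).exists_monotone_subseq
    fun i => g (Nat.nth (· ∈ K) i)
  obtain ⟨j, hj⟩ := exists_increasing_or_nonincreasing_subseq (· < ·)
    fun i => g (Nat.nth (· ∈ K) (h i))
  have hmono : StrictMono fun i => Nat.nth (· ∈ K) (h (j i)) :=
    hnth.comp (h.strictMono.comp j.strictMono)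
  have hsub : Set.range (fun i => Nat.nth (· ∈ K) (h (j i))) ⊆ K := by
    rintro _ ⟨i, rfl⟩
    exact Nat.nth_mem_of_infinite hK _
  have hinf := Set.infinite_range_of_injective hmono.injective
  refine ⟨_, hsub, hinf, ?_⟩
  rcases hj with hj | hj
  · rintro _ ⟨i, rfl⟩ _ ⟨i', rfl⟩ hlt
    exact hj i i' (hmono.lt_iff_lt.1 hlt)
  · refine absurd ?_ (hg _ hsub hinf (g (Nat.nth (· ∈ K) (h (j 0)))))
    rintro _ ⟨i, rfl⟩
    rcases Nat.eq_zero_or_pos i with rfl | hi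
    · rfl
    · exact ((hh _ _ (j.monotone hi.le)).eq_of_not_lt (hj 0 i hi)).symm

/-- The new barrier consists of members of `C` without their last element, and `s` is sent to the
sequence of the values `g (s ∪ {k})`, where `k` runs through the later elements. -/
theorem exists_barrier_incSeq {P : Type*} [PartialOrder P] [WellQuasiOrderedLE P]
    {C : Set (Finset ℕ)} {X : Set ℕ} {g : Finset ℕ → P} (hC : IsFront C X) (h0 : ∅ ∉ C)
    (hg : IsBad (· ≤ ·) C g) (hnc : ∀ s : Finset ℕ, (s : Set ℕ) ⊆ X → ∀ Y ⊆ above s X,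
      Y.Infinite → ∀ c, ¬ ∀ k ∈ Y, insert k s ∈ C ∧ g (insert k s) = c) :
    ∃ D, IsBarrier D ∧ (∀ s ∈ D, ∃ t ∈ C, IsInitSeg s (t : Set ℕ)) ∧
      ∃ φ : D → IncSeq P, ¬ IsGood IncSeqDom φ := by
  obtain ⟨Z, hZX, hZ, hdec⟩ := fusion (fun s Y => (∀ k ∈ Y, insert k s ∉ C) ∨
      ∀ k ∈ Y, insert k s ∈ C ∧ ∀ l ∈ Y, k < l → g (insert k s) < g (insert l s)) hC.infinite
    (fun s Y W hWY h => h.imp (fun h k hk => h k (hWY hk))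
      fun h k hk => ⟨(h k (hWY hk)).1, fun l hl => (h k (hWY hk)).2 l (hWY hl)⟩)
    (fun s hsX Y hY hYi => by
      by_cases hK : {k ∈ Y | insert k s ∈ C}.Finite
      · exact ⟨_, Set.sdiff_subset, hYi.sdiff hK, Or.inl fun k hk hk' => hk.2 ⟨hk.1, hk'⟩⟩
      · obtain ⟨W, hWK, hW, hlt⟩ := exists_strictMono_of_not_constant
          (g := fun k => g (insert k s)) hK fun W hWK hW c hc =>
            hnc s hsX W (fun k hk => hY (hWK hk).1) hW c fun k hk => ⟨(hWK hk).2, hc k hk⟩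
        exact ⟨W, fun k hk => (hWK hk).1, hW, Or.inr fun k hk => ⟨(hWK hk).2, hlt k hk⟩⟩)
  have hne : ∀ s, (above s Z).Nonempty := fun s => (above_infinite s hZ).nonempty
  have hE : IsFront {s | (s : Set ℕ) ⊆ Z ∧ ∀ k ∈ above s Z, insert k s ∈ C} Z := by
    refine ⟨hZ, fun s hs => hs.1, fun s hs t ht hst => ?_, fun Y hYZ hY => ?_⟩
    · by_contra hst'
      obtain ⟨k, hkt, hks, hins⟩ := hst.insert_next (IsInitSeg.refl t) hst hst'
      obtain ⟨l, hl⟩ := hne t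
      have heq := hC.thin _ (hs.2 k ⟨ht.1 hkt, hst.lt_of_notMem hkt hks⟩) _ (ht.2 l hl)
        (hins.trans (isInitSeg_insert_self hl.2))
      have := hins.subset (heq ▸ Finset.mem_insert_self l t)
      exact lt_irrefl l (hl.2 l this)
    · obtain ⟨t, ht, htY⟩ := hC.exists_initSeg Y (hYZ.trans hZX) hY
      have htne : t.Nonempty := Finset.nonempty_iff_ne_empty.2 fun h => h0 (h ▸ ht)
      have hmax : ∀ y ∈ t.erase (t.max' htne), y < t.max' htne := fun y hy =>
        Finset.lt_max'_of_mem_erase_max' t htne hy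
      have hins : insert (t.max' htne) (t.erase (t.max' htne)) = t :=
        Finset.insert_erase (t.max'_mem htne)
      have hst : IsInitSeg (t.erase (t.max' htne)) (t : Set ℕ) := by
        have := isInitSeg_insert_self hmax
        rwa [hins] at this
      have hsZ : ((t.erase (t.max' htne) : Finset ℕ) : Set ℕ) ⊆ Z := hst.1.trans (htY.1.trans hYZ)
      refine ⟨_, ⟨hsZ, ?_⟩, hst.trans htY⟩
      rcases hdec _ hsZ with h | h
      · exact absurd (hins.symm ▸ ht) (h _ ⟨hYZ (htY.1 (t.max'_mem htne)), hmax⟩)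
      · exact fun k hk => (h k hk).1
  have hlt : ∀ s : Finset ℕ, (s : Set ℕ) ⊆ Z → (∀ k ∈ above s Z, insert k s ∈ C) →
      ∀ k ∈ above s Z, ∀ l ∈ above s Z, k < l → g (insert k s) < g (insert l s) := by
    intro s hs hs'
    rcases hdec s hs with h | h
    · obtain ⟨k, hk⟩ := hne s
      exact absurd (hs' k hk) (h k hk)
    · exact fun k hk => (h k hk).2
  -- If `∅` belonged to the front, `C` would contain singletons with increasing values, and `{k} ◁
  -- {l}` would contradict badness.
  have hE0 : ∅ ∉ {s : Finset ℕ | (s : Set ℕ) ⊆ Z ∧ ∀ k ∈ above s Z, insert k s ∈ C} := by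
    rintro ⟨hs, hs'⟩
    have hl := hlt ∅ hs hs'
    rw [above_empty] at hs' hl
    obtain ⟨k, hk⟩ := hZ.nonempty
    obtain ⟨l, hl', hkl⟩ := (infinite_inter_Ioi hZ k).nonempty
    refine hg _ (hs' k hk) _ (hs' l hl') (shift_iff.2 ⟨k, by simpa using hkl, ?_, ?_⟩)
      (hl k hk l hl' hkl).le
    · refine ⟨by simp, fun x hx y hy hxy => ?_⟩
      simp only [insert_empty_eq, Finset.coe_insert, Finset.coe_singleton, Set.mem_insert_iff,
        Set.mem_singleton_iff, Finset.mem_singleton] at hx hy ⊢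
      omega
    · intro h
      have : l ∈ insert k (∅ : Finset ℕ) := h ▸ by simp
      simp only [insert_empty_eq, Finset.mem_singleton] at this
      omega
  obtain ⟨W, hWZ, hW, hD⟩ := hE.exists_isBarrier hE0
  refine ⟨_, hD, fun s hs => ?_, fun s => ⟨fun i => g (insert (Nat.nth (· ∈ above s.1 Z) i) s.1),
    fun i j hij => ?_⟩, ?_⟩
  · obtain ⟨k, hk⟩ := hne s
    exact ⟨_, hs.1.2 k hk, isInitSeg_insert_self hk.2⟩
  · have hinf := above_infinite s.1 hZ
    exact hlt s.1 s.2.1.1 s.2.1.2 _ (Nat.nth_mem_of_infinite hinf i) _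
      (Nat.nth_mem_of_infinite hinf j) (Nat.nth_strictMono hinf hij)
  · rintro ⟨⟨s, hs⟩, ⟨t, ht⟩, hst, hle⟩
    obtain ⟨n, hn, hsn, hsne⟩ := shift_iff.1 hst
    dsimp only at hn hsn hsne
    have hns := hsn.mem_of_nonempty (hD.nonempty hs) hn
    obtain ⟨k, hk, hks, hins⟩ := hsn.insert_next (IsInitSeg.refl _) hsn hsne
    have hkt : k ∈ t := (Finset.mem_insert.1 hk).resolve_left fun h => hks (h ▸ hns)
    have hkZ : k ∈ above s Z := ⟨ht.1.1 hkt, hsn.lt_of_notMem hk hks⟩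
    obtain ⟨i, hi⟩ : k ∈ Set.range (Nat.nth (· ∈ above s Z)) := by
      rw [Nat.range_nth_of_infinite (p := (· ∈ above s Z)) (above_infinite s hZ)]
      exact hkZ
    obtain ⟨j, hj⟩ := hle i
    have hl : Nat.nth (· ∈ above t Z) j ∈ above t Z :=
      Nat.nth_mem_of_infinite (p := (· ∈ above t Z)) (above_infinite t hZ) j
    dsimp only at hj
    rw [hi] at hj
    set l := Nat.nth (· ∈ above t Z) j
    have hnl : n < l := (hn k hkt).trans (hl.2 k hkt)
    have hn' : ∀ x ∈ insert l t, n < x := fun x hx => by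
      rcases Finset.mem_insert.1 hx with rfl | hx
      · exact hnl
      · exact hn x hx
    -- Since `k` is the element following `s` in `{n} ∪ t`, one has `s ∪ {k} ◁ t ∪ {l}` for every
    -- later `l`; hence no term of the second sequence dominates `g (s ∪ {k})`.
    refine hg _ (hs.1.2 k hkZ) _ (ht.1.2 l hl) (shift_iff.2 ⟨n, hn', ?_, ?_⟩) hj
    · refine hins.trans ?_
      have := (isInitSeg_insert_self hl.2).insert_lt (n := n) (by simpa using hn')
      simpa using this
    · intro h
      have : l ∈ insert n t := hins.subset (h ▸ by simp)
      rcases Finset.mem_insert.1 this with h | h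
      · exact hnl.ne' h
      · exact lt_irrefl l (hl.2 l h)

theorem isAlphaBqo_of_incSeq {P : Type*} [PartialOrder P] [WellQuasiOrderedLE P]
    {α : Ordinal.{0}} (h : IsAlphaBqo (@IncSeqDom P _) α) :
    IsAlphaBqo (fun x y : P => x ≤ y) α := by
  rw [isAlphaBqo_iff]
  intro B hB hBα f hf
  obtain ⟨C, X, g, hC, h0, hCB, hg, hnc⟩ := exists_front_nonconstant hB hf
  obtain ⟨D, hD, hDC, φ, hφ⟩ := exists_barrier_incSeq hC h0 hg hnc
  refine hφ (h D hD (hBα.of_extension hD.isFront.thin fun s hs => ?_) φ)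
  obtain ⟨t, ht, hst⟩ := hDC s hs
  obtain ⟨u, hu, htu⟩ := hCB t ht
  exact ⟨u, hu, hst.trans htu⟩

/-! ### Countable subsets of a well-quasi-ordered set -/

/-- If `x` and `y` have no common upper bound in `S`, then `S` is the union of its parts not above
`x` and not above `y`, so one part again lacks a cover. Iterating produces a bad sequence. -/
theorem exists_finite_directed_cover {P : Type*} [Preorder P] [WellQuasiOrderedLE P] (S : Set P) :
    ∃ F : Finset (Set P), (∀ D ∈ F, D ⊆ S ∧ DirectedOn (· ≤ ·) D) ∧ ∀ x ∈ S, ∃ D ∈ F, x ∈ D := by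
  classical
  let Cov : Set P → Prop := fun S => ∃ F : Finset (Set P),
    (∀ D ∈ F, D ⊆ S ∧ DirectedOn (· ≤ ·) D) ∧ ∀ x ∈ S, ∃ D ∈ F, x ∈ D
  have step : ∀ S : {S : Set P // ¬ Cov S}, ∃ (x : P) (T : {S : Set P // ¬ Cov S}),
      x ∈ S.1 ∧ T.1 ⊆ S.1 ∧ ∀ z ∈ T.1, ¬ x ≤ z := by
    rintro ⟨S, hS⟩
    by_contra! hcon
    have hsub : ∀ x ∈ S, Cov {z ∈ S | ¬ x ≤ z} := fun x hx => by
      by_contra h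
      obtain ⟨z, hz, hxz⟩ := hcon x ⟨_, h⟩ hx (Set.sep_subset _ _)
      exact hz.2 hxz
    by_cases hdir : DirectedOn (· ≤ ·) S
    · exact hS ⟨{S}, by simpa using hdir, by simp⟩
    · simp only [DirectedOn] at hdir
      push Not at hdir
      obtain ⟨x, hx, y, hy, hxy⟩ := hdir
      obtain ⟨F, hF, hFc⟩ := hsub x hx
      obtain ⟨G, hG, hGc⟩ := hsub y hy
      refine hS ⟨F ∪ G, fun D hD => ?_, fun z hz => ?_⟩
      · rcases Finset.mem_union.1 hD with hD | hD
        · exact ⟨(hF D hD).1.trans (Set.sep_subset _ _), (hF D hD).2⟩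
        · exact ⟨(hG D hD).1.trans (Set.sep_subset _ _), (hG D hD).2⟩
      · by_cases hxz : x ≤ z
        · obtain ⟨D, hD, hzD⟩ := hGc z ⟨hz, hxy z hz hxz⟩
          exact ⟨D, Finset.mem_union_right _ hD, hzD⟩
        · obtain ⟨D, hD, hzD⟩ := hFc z ⟨hz, hxz⟩
          exact ⟨D, Finset.mem_union_left _ hD, hzD⟩
  by_contra hS
  choose x T hx hT hxT using step
  let a : ℕ → {S : Set P // ¬ Cov S} := fun n => T^[n] ⟨S, hS⟩
  have ha : ∀ n, a (n + 1) = T (a n) := fun n => Function.iterate_succ_apply' _ _ _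
  have hanti : Antitone fun n => (a n).1 :=
    antitone_nat_of_succ_le fun n => by rw [ha]; exact hT _
  obtain ⟨m, n, hmn, hle⟩ := wellQuasiOrdered_le (α := P) fun n => x (a n)
  refine hxT (a m) (x (a n)) ?_ hle
  rw [← ha]
  exact hanti (Nat.succ_le_of_lt hmn) (hx (a n))

/-- Along an enumeration, each step passes above the next listed element and above some element not
below the current bound, which exists as there is no largest element. -/
theorem exists_strictMono_cofinal {P : Type*} [Preorder P] {D : Set P} (hD : D.Countable)
    (hne : D.Nonempty) (hdir : DirectedOn (· ≤ ·) D) (hmax : ¬ ∃ m ∈ D, ∀ d ∈ D, d ≤ m) :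
    ∃ x : ℕ → P, StrictMono x ∧ (∀ n, x n ∈ D) ∧ ∀ d ∈ D, ∃ n, d ≤ x n := by
  obtain ⟨e, rfl⟩ := hD.exists_eq_range hne
  have step : ∀ (n : ℕ) (y : Set.range e), ∃ z : Set.range e, y.1 < z.1 ∧ e n ≤ z.1 := by
    rintro n ⟨y, hy⟩
    obtain ⟨z, hz, hyz, hnz⟩ := hdir y hy (e n) ⟨n, rfl⟩
    push Not at hmax
    obtain ⟨w, hw, hwz⟩ := hmax z hz
    obtain ⟨v, hv, hzv, hwv⟩ := hdir z hz w hw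
    exact ⟨⟨v, hv⟩, lt_of_le_not_ge (hyz.trans hzv) fun h => hwz (hwv.trans (h.trans hyz)),
      hnz.trans hzv⟩
  choose z hz using step
  let x : ℕ → Set.range e := fun n => Nat.rec ⟨e 0, 0, rfl⟩ z n
  refine ⟨fun n => (x n).1, strictMono_nat_of_lt_succ fun n => (hz n (x n)).1, fun n => (x n).2, ?_⟩
  rintro _ ⟨n, rfl⟩
  exact ⟨n + 1, (hz n (x n)).2⟩

theorem Shift.eq_union {s t : Finset ℕ} (h : Shift s t) (hs : s.Nonempty) :
    t = tail s ∪ t \ s ∧ ∀ x ∈ t \ s, ∀ y ∈ s, y < x := by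
  obtain ⟨n, hn, hsn, -⟩ := shift_iff.1 h
  have hns := hsn.mem_of_nonempty hs hn
  constructor
  · ext x
    simp only [Finset.mem_union, Finset.mem_sdiff, mem_tail]
    constructor
    · intro hx
      by_cases hxs : x ∈ s
      · exact Or.inl ⟨hxs, n, hns, hn x hx⟩
      · exact Or.inr ⟨hx, hxs⟩
    · rintro (⟨hx, y, hy, hyx⟩ | hx)
      · refine (Finset.mem_insert.1 (hsn.subset hx)).resolve_left ?_
        rintro rfl
        rcases Finset.mem_insert.1 (hsn.subset hy) with rfl | hy
        · exact lt_irrefl _ hyx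
        · exact lt_asymm hyx (hn y hy)
      · exact hx.1
  · intro x hx
    rw [Finset.mem_sdiff] at hx
    exact hsn.lt_of_notMem (by simp [hx.1]) hx.2

theorem isInitSeg_union_union {v u u' : Finset ℕ} (h : IsInitSeg u (u' : Set ℕ))
    (hv : ∀ x ∈ u', ∀ y ∈ v, y < x) : IsInitSeg (v ∪ u) ((v ∪ u' : Finset ℕ) : Set ℕ) := by
  refine ⟨by simpa using Set.subset_union_of_subset_right h.1 _, fun x hx y hy hxy => ?_⟩
  rcases Finset.mem_union.1 (Finset.mem_coe.1 hx) with hx | hx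
  · exact Finset.mem_union_left _ hx
  · rcases Finset.mem_union.1 hy with hy | hy
    · exact absurd (hv x hx y hy) hxy.not_gt
    · exact Finset.mem_union_right _ (h.2 x hx y hy hxy)

/-- For fixed `s`, the set `t = tail s ∪ (t \ s)` is recovered from `t \ s`, so thinness is
inherited and Ramsey can be applied above `s`. -/
theorem IsBarrier.thin_sdiff {B : Set (Finset ℕ)} (hB : IsBarrier B) {s : Finset ℕ}
    (hs : s.Nonempty) : Thin {u | ∃ t ∈ B, Shift s t ∧ u = t \ s} := by
  rintro _ ⟨t, ht, hst, rfl⟩ _ ⟨t', ht', hst', rfl⟩ h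
  obtain ⟨h1, -⟩ := hst.eq_union hs
  obtain ⟨h1', h2'⟩ := hst'.eq_union hs
  have := isInitSeg_union_union h fun x hx y hy => h2' x hx y (mem_tail.1 hy).1
  rw [← h1, ← h1'] at this
  rw [hB.isFront.thin t ht t' ht' this]

theorem isAlphaBqo_countableDom {P : Type*} [PartialOrder P] [WellQuasiOrderedLE P]
    {α : Ordinal.{0}} (hS : IsAlphaBqo (@IncSeqDom P _) α) :
    IsAlphaBqo (@CountableDom P _) α := by
  classical
  have hP := isAlphaBqo_of_incSeq hS
  rw [isAlphaBqo_iff] at hP ⊢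
  intro B hB hBα F hF
  have hex : ∀ s ∈ B, ∀ t ∈ B, Shift s t → ∃ x ∈ (F s).1, ∀ y ∈ (F t).1, ¬ x ≤ y := by
    intro s hs t ht hst
    have := hF s hs t ht hst
    simp only [CountableDom, Dom] at this
    push Not at this
    exact this
  have hne : Nonempty P := by
    obtain ⟨s, hs, t, ht, -, -, hst⟩ := hB.exists_shift hB.isFront.infinite subset_rfl
    exact ⟨(hex s hs t ht hst).choose⟩
  choose! x hxF hx using hex
  obtain ⟨X, hXB, hX, hdec⟩ := fusion (fun s Y => s ∈ B → ∃ D ⊆ (F s).1, DirectedOn (· ≤ ·) D ∧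
      ∀ t ∈ B, Shift s t → ((t \ s : Finset ℕ) : Set ℕ) ⊆ Y → x s t ∈ D) hB.isFront.infinite
    (fun s Y Z hZY h hs => by
      obtain ⟨D, hDF, hD, hxD⟩ := h hs
      exact ⟨D, hDF, hD, fun t ht hst hY => hxD t ht hst (hY.trans hZY)⟩)
    (fun s _ Y _ hYi => by
      by_cases hs : s ∈ B
      swap
      · exact ⟨Y, subset_rfl, hYi, fun h => absurd h hs⟩
      obtain ⟨𝒟, h𝒟, hcov⟩ := exists_finite_directed_cover (F s).1
      choose! c hc𝒟 hc using hcov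
      obtain ⟨t₀, ht₀, -, hst₀⟩ := hB.exists_shift_of_mem hB.isFront.infinite subset_rfl hs
        (hB.isFront.subset s hs)
      have hmem : ∀ t ∈ B, Shift s t → c (x s (tail s ∪ t \ s)) ∈ 𝒟 := fun t ht hst => by
        rw [← (hst.eq_union (hB.nonempty hs)).1]
        exact hc𝒟 _ (hxF s hs t ht hst)
      obtain ⟨Z, hZY, hZ, D, hD, hcol⟩ := (hB.thin_sdiff (hB.nonempty hs)).exists_monochromatic
        (fun u => c (x s (tail s ∪ u))) 𝒟 ⟨_, hmem t₀ ht₀ hst₀⟩ hYi (by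
          rintro _ ⟨t, ht, hst, rfl⟩ -
          exact hmem t ht hst)
      refine ⟨Z, hZY, hZ, fun _ => ⟨D, (h𝒟 D hD).1, (h𝒟 D hD).2, fun t ht hst htZ => ?_⟩⟩
      have := hcol _ ⟨t, ht, hst, rfl⟩ htZ
      rw [← (hst.eq_union (hB.nonempty hs)).1] at this
      exact this ▸ hc _ (hxF s hs t ht hst))
  have hdec' : ∀ s ∈ restrict B X, ∃ D ⊆ (F s).1, DirectedOn (· ≤ ·) D ∧ D.Nonempty ∧
      ∀ t ∈ restrict B X, Shift s t → x s t ∈ D := by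
    intro s hs
    obtain ⟨D, hDF, hD, hxD⟩ := hdec s hs.2 hs.1
    have hxD' : ∀ t ∈ restrict B X, Shift s t → x s t ∈ D := fun t ht hst =>
      hxD t ht.1 hst fun y hy => by
        have hy' := (hst.eq_union (hB.nonempty hs.1)).2 y hy
        exact ⟨ht.2 (Finset.mem_sdiff.1 hy).1, hy'⟩
    obtain ⟨t, ht, htX, hst⟩ := hB.exists_shift_of_mem hX hXB hs.1 hs.2
    exact ⟨D, hDF, hD, ⟨_, hxD' t ⟨ht, htX⟩ hst⟩, hxD'⟩
  choose! D hDF hdir hDne hxD using hdec'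
  have hbad : IsBad Dom (restrict B X) D := by
    intro s hs t ht hst hle
    obtain ⟨y, hy, hxy⟩ := hle _ (hxD s hs t ht hst)
    exact hx s hs.1 t ht.1 hst y (hDF t ht hy) hxy
  -- Uniformly, either all the directed pieces have a largest element, giving a bad map into `P`, or
  -- none has, and cofinal sequences give a bad map into `S_ω(P)`.
  obtain ⟨Y, hYX, hY, hcase⟩ := hB.isFront.thin.exists_homogeneous
    (fun s => ∃ m ∈ D s, ∀ d ∈ D s, d ≤ m) hX
  have hBY := hB.restrict (hYX.trans hXB) hY
  have htype : OrderTypeLE (restrict B Y) α := hBα.subset hB.isFront.thin (Set.sep_subset _ _)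
  have hYX' : ∀ s ∈ restrict B Y, s ∈ restrict B X := fun s hs => ⟨hs.1, hs.2.trans hYX⟩
  rcases hcase with hcase | hcase
  · choose! m hm hle using hcase
    refine hP _ hBY htype m fun s hs t ht hst hmm => ?_
    exact hbad s (hYX' s hs) t (hYX' t ht) hst fun d hd =>
      ⟨m t, hm t ht.1 ht.2, (hle s hs.1 hs.2 d hd).trans hmm⟩
  · have hseq : ∀ s : restrict B Y, ∃ z : IncSeq P, (∀ n, z.1 n ∈ D s.1) ∧
        ∀ d ∈ D s.1, ∃ n, d ≤ z.1 n := fun s => by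
      obtain ⟨z, hz, hzD, hcof⟩ := exists_strictMono_cofinal
        ((F s.1).2.mono (hDF s.1 (hYX' _ s.2))) (hDne s.1 (hYX' _ s.2)) (hdir s.1 (hYX' _ s.2))
        (hcase s.1 s.2.1 s.2.2)
      exact ⟨⟨z, hz⟩, hzD, hcof⟩
    choose z hzD hcof using hseq
    obtain ⟨s, t, hst, hle⟩ := hS _ hBY htype z
    refine hbad s.1 (hYX' _ s.2) t.1 (hYX' _ t.2) hst fun d hd => ?_
    obtain ⟨n, hn⟩ := hcof s d hd
    obtain ⟨k, hk⟩ := hle n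
    exact ⟨_, hzD t k, hn.trans hk⟩

/-! ### From countable subsets of `P` back to `P` -/

/-- Here `ω ^ γ` is the leading power of `α`; finite multiples of it are absorbed by the factor `ω`,
and `ω ≤ α` makes `γ` nonzero. -/
theorem exists_omega0_opow_mul_eq {α : Ordinal.{0}} (hα : ω ≤ α) :
    ∃ γ : Ordinal.{0}, γ ≠ 0 ∧ ω ^ γ ≤ α ∧ α * ω = ω ^ γ * ω := by
  have h0 : α ≠ 0 := (Ordinal.omega0_pos.trans_le hα).ne'
  have hlt : α < ω ^ Ordinal.log ω α * ω := by
    rw [← Ordinal.opow_succ]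
    exact Ordinal.lt_opow_succ_log_self Ordinal.one_lt_omega0 α
  have hle := Ordinal.opow_log_le_self ω h0
  refine ⟨Ordinal.log ω α, fun h => ?_, hle, le_antisymm ?_ (by gcongr)⟩
  · rw [h, Ordinal.opow_zero, one_mul] at hlt
    exact hlt.not_ge hα
  · obtain ⟨i, a, ha, hi⟩ :=
      exists_eq_mul_natCast_add (Ordinal.opow_pos _ Ordinal.omega0_pos) hlt
    calc α * ω ≤ (ω ^ Ordinal.log ω α * ((i + 1 : ℕ) : Ordinal.{0})) * ω := by
          gcongr
          rw [Nat.cast_succ, mul_add, mul_one]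
          conv_lhs => rw [hi]
          gcongr
      _ = ω ^ Ordinal.log ω α * ω := by
          rw [mul_assoc, Ordinal.natCast_mul_omega0 (Nat.succ_pos i)]

/-- A barrier of order type at most `κω` has a restriction on which the members with a given
least element are ranked, for the lexicographic order, by ordinals below `κ`. -/
theorem IsBarrier.exists_rank_of_mul_omega0 {B : Set (Finset ℕ)} (hB : IsBarrier B)
    {κ : Ordinal.{0}} (hκ : 0 < κ) (h : OrderTypeLE B (κ * ω)) :
    ∃ X ⊆ base B, X.Infinite ∧ ∃ ε : Finset ℕ → Ordinal.{0}, (∀ r ∈ B, ε r < κ) ∧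
      ∀ n, ∀ r ∈ Bqo.restrict B X, ∀ r' ∈ Bqo.restrict B X, n ∈ r → n ∈ r' → (∀ x ∈ r, n ≤ x) →
        (∀ x ∈ r', n ≤ x) → LexAt r r' → ε r < ε r' := by
  obtain ⟨φ, hφ⟩ := h.exists_isLexRank
  have hex : ∀ r ∈ B, ∃ (q : ℕ) (e : Ordinal.{0}), e < κ ∧ φ r = κ * q + e :=
    fun r hr => exists_eq_mul_natCast_add hκ (hφ.1 r hr)
  choose! q ε hε hq using hex
  have hlex : ∀ r ∈ B, ∀ r' ∈ B, LexAt r r' → q r < q r' ∨ q r = q r' ∧ ε r < ε r' := by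
    intro r hr r' hr' hrr'
    have := hφ.2 r hr r' hr' hrr'
    rw [hq r hr, hq r' hr'] at this
    exact mul_natCast_add_lt (hε r' hr') this
  have hle : ∀ r ∈ B, ∀ r' ∈ B, LexAt r r' → q r ≤ q r' := fun r hr r' hr' hrr' =>
    (hlex r hr r' hr' hrr').elim le_of_lt fun h => h.1.le
  obtain ⟨X, hXB, hX, hdec⟩ := fusion (fun s Y => ∀ n, s = {n} → ∀ r ∈ B, ∀ r' ∈ B, n ∈ r →
      n ∈ r' → (r : Set ℕ) ⊆ insert n Y → (r' : Set ℕ) ⊆ insert n Y → q r = q r')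
    hB.isFront.infinite
    (fun s Y Z hZY h n hn r hr r' hr' hnr hnr' h1 h2 => h n hn r hr r' hr' hnr hnr'
      (h1.trans (Set.insert_subset_insert hZY)) (h2.trans (Set.insert_subset_insert hZY)))
    (fun s hs Y hYs hY => by
      by_cases hsn : ∃ n, s = {n}
      swap
      · exact ⟨Y, subset_rfl, hY, fun n hn => absurd ⟨n, hn⟩ hsn⟩
      obtain ⟨n, rfl⟩ := hsn
      have hnY : ∀ y ∈ Y, n < y := fun y hy => (hYs hy).2 n (by simp)
      by_cases hS : ({r ∈ B | n ∈ r ∧ ∀ x ∈ r, n ≤ x}).Nonempty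
      swap
      · refine ⟨Y, subset_rfl, hY, fun m hm r hr _ _ hnr _ h1 _ => absurd ⟨r, hr, ?_⟩ hS⟩
        obtain rfl := Finset.singleton_injective hm
        exact ⟨hnr, fun x hx => (h1 hx).elim Eq.ge fun h => (hnY x h).le⟩
      -- Members with least element `n` precede `r₁`, which lies beyond `n`; this bounds their
      -- quotients `q`.
      obtain ⟨r₁, hr₁, hr₁Y⟩ := hB.isFront.exists_initSeg Y (hYs.trans (above_subset _ _)) hY
      have hbdd : BddAbove (q '' {r ∈ B | n ∈ r ∧ ∀ x ∈ r, n ≤ x}) := by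
        refine ⟨q r₁, ?_⟩
        rintro _ ⟨r, ⟨hr, hnr, hmin⟩, rfl⟩
        refine hle r hr r₁ hr₁ ⟨n, hnr, fun h => lt_irrefl n (hnY n (hr₁Y.1 h)), ?_, fun x hx => ?_⟩
        · obtain ⟨b, hb⟩ := hB.nonempty hr₁
          exact ⟨b, hb, hnY b (hr₁Y.1 hb)⟩
        · exact ⟨fun h => absurd (hmin x h) hx.not_ge,
            fun h => absurd (hnY x (hr₁Y.1 h)) hx.not_gt⟩
      obtain ⟨r₀, ⟨hr₀, hnr₀, -⟩, hmax⟩ := Nat.sSup_mem (hS.image q) hbdd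
      -- With `r₀` of maximal quotient and all elements after `n` taken beyond `r₀`, every other
      -- such `r` follows `r₀` lexicographically, so its quotient is also maximal.
      have key : ∀ r ∈ B, n ∈ r → (r : Set ℕ) ⊆ insert n {y ∈ Y | r₀.sup id < y} →
          q r = q r₀ := by
        intro r hr hnr hrY
        by_cases hne : r₀ = r
        · rw [hne]
        refine le_antisymm ?_ ?_
        · rw [hmax]
          exact le_csSup hbdd ⟨r, ⟨hr, hnr, fun x hx =>
            (hrY hx).elim Eq.ge fun h => (hnY x h.1).le⟩, rfl⟩
        · rcases hB.isFront.thin.lexAt_or hr₀ hr hne with h | ⟨a, ha, ha', ⟨b, hb, hab⟩, -⟩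
          · exact hle _ hr₀ _ hr h
          · exfalso
            rcases hrY ha with rfl | ⟨-, h⟩
            · exact ha' hnr₀
            · have : b ≤ r₀.sup id := Finset.le_sup (f := id) hb
              omega
      refine ⟨_, Set.sep_subset _ _, infinite_inter_Ioi hY (r₀.sup id),
        fun m hm r hr r' hr' hnr hnr' h1 h2 => ?_⟩
      obtain rfl := Finset.singleton_injective hm
      rw [key r hr hnr h1, key r' hr' hnr' h2])
  refine ⟨X, hXB, hX, ε, hε, fun n r hr r' hr' hnr hnr' hmin hmin' hrr' => ?_⟩
  have hsub : ∀ r : Finset ℕ, (r : Set ℕ) ⊆ X → (∀ x ∈ r, n ≤ x) →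
      (r : Set ℕ) ⊆ insert n (above {n} X) := fun r hrX hmin x hx => by
    rcases eq_or_lt_of_le (hmin x hx) with rfl | h
    · exact Set.mem_insert _ _
    · exact Set.mem_insert_of_mem _ ⟨hrX hx, by simpa using h⟩
  have := hdec {n} (by simpa using hr.2 hnr) n rfl r hr.1 r' hr'.1 hnr hnr'
    (hsub r hr.2 hmin) (hsub r' hr'.2 hmin')
  rcases hlex r hr.1 r' hr'.1 hrr' with h | h
  · exact absurd this h.ne
  · exact h.2

/-- For every `n ∈ X` below `t`, the set `{n} ∪ t` has an initial segment in `B`. -/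
def Resolves (B : Set (Finset ℕ)) (X : Set ℕ) (t : Finset ℕ) : Prop :=
  ∀ n ∈ X, (∀ x ∈ t, n < x) → ∃ r ∈ B, IsInitSeg r (insert n t : Finset ℕ)

/-- The minimal nonempty subsets of `X`, without its least element, that resolve `B` on `X`. -/
def resolvent (B : Set (Finset ℕ)) (X : Set ℕ) : Set (Finset ℕ) :=
  {t | (t : Set ℕ) ⊆ X \ {sInf X} ∧ t.Nonempty ∧ Resolves B X t ∧
    ∀ u, IsInitSeg u (t : Set ℕ) → u.Nonempty → Resolves B X u → u = t}

/-- If a non-singleton `t'` contains `t`, its last element is needed for some `n`, so the member of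
`B` for that `n` is all of `{n} ∪ t'`. The member found in `{n} ∪ t` lies inside it, hence equals
it, and `t = t'`. For the front property, only the finitely many `n` below the least element of `Y`
must be resolved. -/
theorem IsBarrier.resolvent {B : Set (Finset ℕ)} (hB : IsBarrier B) {X : Set ℕ}
    (hXB : X ⊆ base B) (hX : X.Infinite) : IsBarrier (resolvent B X) := by
  classical
  have hanti : IsAntichain (· ⊆ ·) (Bqo.resolvent B X) := by
    intro t ht t' ht' hne hsub
    have hmax : ∀ y ∈ t'.erase (t'.max' ht'.2.1), y < t'.max' ht'.2.1 := fun y hy =>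
      Finset.lt_max'_of_mem_erase_max' t' ht'.2.1 hy
    have hbt := t'.max'_mem ht'.2.1
    set b := t'.max' ht'.2.1
    have hins : insert b (t'.erase b) = t' := Finset.insert_erase hbt
    have hu : IsInitSeg (t'.erase b) (t' : Set ℕ) := by
      have := isInitSeg_insert_self hmax
      rwa [hins] at this
    rcases (t'.erase b).eq_empty_or_nonempty with he | he
    · rw [he] at hins
      rw [← hins] at hsub
      exact hne (((Finset.subset_singleton_iff.1 hsub).resolve_left ht.2.1.ne_empty).trans hins)
    · have hnres : ¬ Resolves B X (t'.erase b) := fun h =>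
        Finset.notMem_erase b t' ((ht'.2.2.2 _ hu he h).symm ▸ hbt)
      simp only [Resolves] at hnres
      push Not at hnres
      obtain ⟨n, hnX, hn, hno⟩ := hnres
      obtain ⟨y, hy⟩ := he
      have hn' : ∀ x ∈ t', n < x := fun x hx => by
        rw [← hins] at hx
        rcases Finset.mem_insert.1 hx with rfl | hx
        · exact (hn y hy).trans (hmax y hy)
        · exact hn x hx
      obtain ⟨r', hr', hr't⟩ := ht'.2.2.1 n hnX hn'
      obtain ⟨r, hr, hrt⟩ := ht.2.2.1 n hnX fun x hx => hn' x (hsub hx)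
      have hbr : b ∈ r' := by
        by_contra hbr
        refine hno r' hr' (hr't.mono (fun x hx => ?_) ?_)
        · have hx' := hr't.subset hx
          rw [Finset.mem_insert] at hx'
          rw [Finset.mem_coe, Finset.mem_insert, Finset.mem_erase]
          exact hx'.imp id fun h => ⟨fun h' => hbr (h' ▸ hx), h⟩
        · exact Finset.coe_subset.2 (Finset.insert_subset_insert n (Finset.erase_subset b t'))
      have hr'eq : insert n t' ⊆ r' := fun x hx => by
        refine hr't.2 x hx b hbr ?_
        rcases Finset.mem_insert.1 hx with rfl | hx
        · exact (hn' b hbt).le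
        · exact t'.le_max' x hx
      have hrr' : r = r' := by
        by_contra hne'
        exact hB.2 hr hr' hne' ((hrt.subset.trans (Finset.insert_subset_insert n hsub)).trans hr'eq)
      refine hne (Finset.Subset.antisymm hsub fun x hx => ?_)
      have hxr : x ∈ r := hrr' ▸ hr'eq (Finset.mem_insert_of_mem hx)
      exact (Finset.mem_insert.1 (hrt.subset hxr)).resolve_left (hn' x hx).ne'
  refine IsFront.isBarrier (M := X \ {sInf X}) ⟨hX.sdiff (Set.finite_singleton _),
    fun t ht => ht.1, thin_of_isAntichain hanti, fun Y hYX hY => ?_⟩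
    (fun h => Finset.not_nonempty_empty h.2.1) hanti
  have hmin : ∀ y ∈ Y, sInf Y ≤ y := fun y hy => Nat.sInf_le hy
  have hmY := Nat.sInf_mem hY.nonempty
  set m := sInf Y
  have hex : ∀ n ∈ X, n < m → ∃ r ∈ B, IsInitSeg r (insert n Y) := fun n hn _ =>
    hB.isFront.exists_initSeg _
      ((Set.insert_subset hn (hYX.trans Set.sdiff_subset)).trans hXB)
      (hY.mono (Set.subset_insert _ _))
  choose! R hRB hRY using hex
  set N := max m ((Finset.range m).sup fun n => (R n).sup id)
  let t₀ : Finset ℕ := (Finset.range (N + 1)).filter (· ∈ Y)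
  have ht₀ : ∀ x, x ∈ t₀ ↔ x ≤ N ∧ x ∈ Y := fun x => by
    simp [t₀]
  have ht₀Y : IsInitSeg t₀ Y := ⟨fun x hx => ((ht₀ x).1 hx).2,
    fun x hx y hy hxy => (ht₀ x).2 ⟨hxy.trans ((ht₀ y).1 hy).1, hx⟩⟩
  have hmt₀ : m ∈ t₀ := (ht₀ m).2 ⟨le_max_left _ _, hmY⟩
  have hres : Resolves B X t₀ := by
    intro n hn hnt
    have hnm := hnt m hmt₀
    refine ⟨R n, hRB n hn hnm, (hRY n hn hnm).mono (fun x hx => ?_) ?_⟩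
    · rw [Finset.mem_coe, Finset.mem_insert, ht₀]
      refine ((hRY n hn hnm).1 hx).imp id fun hxY => ⟨?_, hxY⟩
      refine le_trans ?_ (le_max_right _ _)
      exact (Finset.le_sup (f := id) hx).trans
        (Finset.le_sup (f := fun n => (R n).sup id) (Finset.mem_range.2 hnm))
    · rw [Finset.coe_insert]
      exact Set.insert_subset_insert ht₀Y.1
  obtain ⟨u, ⟨hut, hune, hures⟩, hu⟩ := (wellFounded_lt (α := Finset ℕ)).has_min
    {u | IsInitSeg u (t₀ : Set ℕ) ∧ u.Nonempty ∧ Resolves B X u}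
    ⟨t₀, IsInitSeg.refl t₀, ⟨m, hmt₀⟩, hres⟩
  refine ⟨u, ⟨(hut.trans ht₀Y).1.trans hYX, hune, hures, fun v hv hvne hvres => ?_⟩,
    hut.trans ht₀Y⟩
  by_contra hne
  exact hu v ⟨hv.trans hut, hvne, hvres⟩ (lt_of_le_of_ne hv.subset hne)

theorem LexAt.insert {n : ℕ} {t t' : Finset ℕ} (h : LexAt t t') (hn : ∀ x ∈ t, n < x) :
    LexAt (insert n t) (insert n t') := by
  obtain ⟨a, ha, ha', ⟨b, hb, hab⟩, h⟩ := h
  refine ⟨a, Finset.mem_insert_of_mem ha, fun h' => ?_, ⟨b, Finset.mem_insert_of_mem hb, hab⟩,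
    fun x hx => ?_⟩
  · exact (Finset.mem_insert.1 h').elim (hn a ha).ne' ha'
  · rw [Finset.mem_insert, Finset.mem_insert, h x hx]

/-- The rank of `t` is the natural sum of the ranks of the members resolved by `t`, one for each `n
∈ X` below it. A lexicographic increase never lowers a summand; it either adds summands or strictly
raises one. -/
theorem IsBarrier.orderTypeLE_resolvent {B : Set (Finset ℕ)} (hB : IsBarrier B) {X : Set ℕ}
    (hXB : X ⊆ base B) (hX : X.Infinite) {γ : Ordinal.{0}} (hγ : γ ≠ 0)
    {ε : Finset ℕ → Ordinal.{0}} (hε : ∀ r ∈ B, ε r < ω ^ γ)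
    (hlex : ∀ n, ∀ r ∈ Bqo.restrict B X, ∀ r' ∈ Bqo.restrict B X, n ∈ r → n ∈ r' → (∀ x ∈ r, n ≤ x) →
        (∀ x ∈ r', n ≤ x) → LexAt r r' → ε r < ε r') :
    OrderTypeLE (Bqo.resolvent B X) (ω ^ γ) := by
  classical
  have hex : ∀ t ∈ Bqo.resolvent B X, ∀ n ∈ X, (∀ x ∈ t, n < x) →
      ∃ r ∈ B, IsInitSeg r (insert n t : Finset ℕ) := fun t ht => ht.2.2.1
  choose! R hRB hRt using hex
  have hlow : ∀ {t : Finset ℕ} {n : ℕ}, n < sInf (t : Set ℕ) → ∀ x ∈ t, n < x := fun hn x hx =>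
    hn.trans_le (Nat.sInf_le hx)
  -- Indices outside `X` contribute zero, so the sum may run over all `n` below the least element of
  -- `t`.
  let e : Finset ℕ → ℕ → Ordinal.{0} := fun t n => if n ∈ X then ε (R t n) else 0
  have hR : ∀ t ∈ Bqo.resolvent B X, ∀ n ∈ X, (∀ x ∈ t, n < x) →
      R t n ∈ Bqo.restrict B X ∧ n ∈ R t n ∧ ∀ x ∈ R t n, n ≤ x := by
    intro t ht n hnX hn
    have hrt := hRt t ht n hnX hn
    have hr := hRB t ht n hnX hn
    refine ⟨⟨hr, hrt.1.trans ?_⟩, hrt.mem_of_nonempty (hB.nonempty hr) hn, fun x hx => ?_⟩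
    · rw [Finset.coe_insert]
      exact Set.insert_subset hnX (ht.1.trans Set.sdiff_subset)
    · exact (Finset.mem_insert.1 (hrt.subset hx)).elim Eq.ge fun h => (hn x h).le
  have hcmp : ∀ t ∈ Bqo.resolvent B X, ∀ t' ∈ Bqo.resolvent B X, LexAt t t' → ∀ n ∈ X,
      (∀ x ∈ t, n < x) → (∀ x ∈ t', n < x) → R t n = R t' n ∨ ε (R t n) < ε (R t' n) := by
    intro t ht t' ht' htt' n hnX hn hn'
    by_cases heq : R t n = R t' n
    · exact Or.inl heq
    obtain ⟨h1, h2, h3⟩ := hR t ht n hnX hn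
    obtain ⟨h1', h2', h3'⟩ := hR t' ht' n hnX hn'
    refine Or.inr (hlex n _ h1 _ h1' h2 h2' h3 h3' ?_)
    refine (hB.isFront.thin.lexAt_or h1.1 h1'.1 heq).resolve_right fun h => ?_
    exact (htt'.insert hn).lexLT.asymm (h.extend (hRt t' ht' n hnX hn') (hRt t ht n hnX hn)).lexLT
  refine IsLexRank.orderTypeLE (φ := fun t => natSum (e t) (sInf (t : Set ℕ)))
    ⟨fun t ht => natSum_lt_omega0_opow hγ fun n hn => ?_, fun t ht t' ht' htt' => ?_⟩
    (thin_of_isAntichain (hB.resolvent hXB hX).2)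
  · simp only [e]
    split_ifs with hnX
    · exact hε _ (hRB t ht n hnX (hlow hn))
    · exact Ordinal.opow_pos _ Ordinal.omega0_pos
  · have hmt : sInf (t : Set ℕ) ∈ t := Nat.sInf_mem (Finset.coe_nonempty.2 ht.2.1)
    have hmt' : sInf (t' : Set ℕ) ∈ t' := Nat.sInf_mem (Finset.coe_nonempty.2 ht'.2.1)
    obtain ⟨a, ha, ha', ⟨b, hb, hab⟩, hlt⟩ := id htt'
    have hle : sInf (t : Set ℕ) ≤ sInf (t' : Set ℕ) := by
      by_contra! hcon
      have h1 : sInf (t : Set ℕ) ≤ a := Nat.sInf_le ha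
      have h2 := (hlt _ (hcon.trans_le h1)).2 hmt'
      exact hcon.not_ge (Nat.sInf_le h2)
    have hele : ∀ n < sInf (t : Set ℕ), e t n ≤ e t' n := by
      intro n hn
      simp only [e]
      split_ifs with hnX
      · rcases hcmp t ht t' ht' htt' n hnX (hlow hn) (hlow (hn.trans_le hle)) with h | h
        · rw [h]
        · exact h.le
      · exact le_rfl
    rcases hle.lt_or_eq with hlt' | heq
    · exact (natSum_le_natSum hele).trans_lt (natSum_strictMono _ hlt')
    · simp only [← heq]
      refine natSum_lt_natSum hele ?_
      by_contra! hcon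
      have hReq : ∀ n < sInf (t : Set ℕ), n ∈ X → R t n = R t' n := by
        intro n hn hnX
        refine (hcmp t ht t' ht' htt' n hnX (hlow hn) (hlow (hn.trans_le hle))).resolve_right ?_
        have := hcon n hn
        simp only [e, if_pos hnX] at this
        exact this.not_gt
      have hma : sInf (t : Set ℕ) < a := lt_of_le_of_ne (Nat.sInf_le ha) fun h =>
        ha' (h ▸ heq ▸ hmt')
      have hu : IsInitSeg (t.filter (· < a)) (t : Set ℕ) := by
        refine ⟨Finset.coe_subset.2 (Finset.filter_subset _ _), fun x hx y hy hxy => ?_⟩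
        exact Finset.mem_filter.2 ⟨hx, hxy.trans_lt (Finset.mem_filter.1 hy).2⟩
      have hmu : sInf (t : Set ℕ) ∈ t.filter (· < a) := Finset.mem_filter.2 ⟨hmt, hma⟩
      -- If no summand changed, each resolved member would begin both `{n} ∪ t` and `{n} ∪ t'` and
      -- so stop before the first difference `a`; the part of `t` below `a` would already resolve,
      -- against minimality.
      have hres : Resolves B X (t.filter (· < a)) := by
        intro n hnX hn
        have hnm := hn _ hmu
        have hrt := hRt t ht n hnX (hlow hnm)
        have hrt' := hRt t' ht' n hnX (hlow (hnm.trans_le hle))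
        rw [← hReq n hnm hnX] at hrt'
        refine ⟨R t n, hRB t ht n hnX (hlow hnm), hrt.mono (fun x hx => ?_) ?_⟩
        · rw [Finset.mem_coe, Finset.mem_insert, Finset.mem_filter]
          refine (Finset.mem_insert.1 (hrt.subset hx)).imp id fun hxt => ⟨hxt, ?_⟩
          by_contra! hax
          have har := hrt.2 a (by simp [ha]) x hx hax
          exact (Finset.mem_insert.1 (hrt'.subset har)).elim (hnm.trans hma).ne' ha'
        · exact Finset.coe_subset.2 (Finset.insert_subset_insert n (Finset.filter_subset _ _))
      have := ht.2.2.2 _ hu ⟨_, hmu⟩ hres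
      rw [← this] at ha
      exact lt_irrefl a (Finset.mem_filter.1 ha).2

theorem isAlphaBqo_mul_omega0 {P : Type*} [Preorder P] {α : Ordinal.{0}} (hα : ω ≤ α)
    (h : IsAlphaBqo (@CountableDom P _) α) : IsAlphaBqo (fun x y : P => x ≤ y) (α * ω) := by
  obtain ⟨γ, hγ, hγα, hmul⟩ := exists_omega0_opow_mul_eq hα
  rw [hmul]
  rw [isAlphaBqo_iff] at h ⊢
  intro B hB hBtype f hf
  obtain ⟨X, hXB, hX, ε, hε, hlex⟩ :=
    hB.exists_rank_of_mul_omega0 (Ordinal.opow_pos _ Ordinal.omega0_pos) hBtype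
  have hC := hB.resolvent hXB hX
  have hCtype := (hB.orderTypeLE_resolvent hXB hX hγ hε hlex).mono hγα
  -- The set at `s` collects the values of `f` at the members resolved in `{min s} ∪ t` for all `t`
  -- with `s ◁ t`. If `s ◁ t ◁ u`, a member from `{min s} ∪ t` is in shift relation to any member
  -- from `{min t} ∪ u`, which transfers badness.
  refine h _ hC hCtype (fun s => ⟨f '' {r | r ∈ B ∧ ∃ t ∈ resolvent B X, Shift s t ∧
    IsInitSeg r (insert (sInf (s : Set ℕ)) t : Finset ℕ)}, (Set.to_countable _).image f⟩) ?_
  have hmin : ∀ {s t : Finset ℕ} {n : ℕ}, s.Nonempty → (∀ x ∈ t, n < x) →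
      IsInitSeg s (insert n t : Finset ℕ) → n ∈ s ∧ sInf (s : Set ℕ) = n := by
    intro s t n hs hn hst
    have hns := hst.mem_of_nonempty hs hn
    refine ⟨hns, le_antisymm (Nat.sInf_le hns) (le_csInf ⟨n, hns⟩ fun x hx => ?_)⟩
    exact (Finset.mem_insert.1 (hst.subset hx)).elim Eq.ge fun h => (hn x h).le
  intro s hs t ht hst hle
  obtain ⟨n, hn, hsn, -⟩ := shift_iff.1 hst
  obtain ⟨hns, hsinf⟩ := hmin hs.2.1 hn hsn
  obtain ⟨r, hr, hrt⟩ := ht.2.2.1 n (hs.1 hns).1 hn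
  obtain ⟨_, ⟨r', ⟨hr', u, hu, htu, hr'u⟩, rfl⟩, hrr'⟩ :=
    hle (f r) ⟨r, ⟨hr, t, ht, hst, hsinf.symm ▸ hrt⟩, rfl⟩
  obtain ⟨m, hm, htm, -⟩ := shift_iff.1 htu
  obtain ⟨hmt, htinf⟩ := hmin ht.2.1 hm htm
  rw [htinf] at hr'u
  have hnu : ∀ x ∈ ((insert m u : Finset ℕ) : Set ℕ), n < x := by
    intro x hx
    rcases Finset.mem_insert.1 (Finset.mem_coe.1 hx) with rfl | hx
    · exact hn _ hmt
    · exact (hn m hmt).trans (hm x hx)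
  exact hf r hr r' hr' (hB.shift hnu hr hr' (hrt.trans (htm.insert_lt hnu)) hr'u) hrr'

end Bqo

/-! ### The equivalence and the bqo criterion -/

theorem theorem2p16 {P : Type*} [PartialOrder P] :
    (∀ α : Ordinal.{0}, ω ≤ α → α < ω₁ →
      List.TFAE [
        Bqo.IsAlphaBqo (fun x y : P => x ≤ y) (α * ω),
        Bqo.IsAlphaBqo (fun x y : P => x ≤ y) ω ∧ Bqo.IsAlphaBqo (@Bqo.IncSeqDom P _) α,
        WellQuasiOrderedLE P ∧ Bqo.IsAlphaBqo (@Bqo.IncSeqDom P _) α,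
        Bqo.IsAlphaBqo (@Bqo.CountableDom P _) α,
        Bqo.IsAlphaBqo (@Bqo.Dom P _) α]) ∧
    (WellQuasiOrderedLE P → Bqo.IsBqo (@Bqo.IncSeqDom P _) →
      Bqo.IsBqo (fun x y : P => x ≤ y)) := by
  -- The final assertion needs no factor `ω`: at each `α`, the property passes directly from
  -- `S_ω(P)` to `P`.
  refine ⟨fun α hα _ => ?_, fun _ hS α hα hα' => Bqo.isAlphaBqo_of_incSeq (hS α hα hα')⟩
  tfae_have 1 → 5 := Bqo.isAlphaBqo_dom
  tfae_have 5 → 4 := fun h => h.comap Subtype.val fun _ _ h => h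
  tfae_have 4 → 2 := by
    intro h
    refine ⟨(h.mono hα).comap (fun x => ⟨{x}, Set.countable_singleton x⟩) fun x y hxy => ?_,
      h.comap (fun x => ⟨Set.range x.1, Set.countable_range x.1⟩) fun x y hxy n => ?_⟩
    · obtain ⟨z, rfl, hz⟩ := hxy x rfl
      exact hz
    · obtain ⟨_, ⟨m, rfl⟩, hm⟩ := hxy (x.1 n) ⟨n, rfl⟩
      exact ⟨m, hm⟩
  tfae_have 2 → 3 := fun h => ⟨Bqo.wellQuasiOrderedLE_of_isAlphaBqo h.1, h.2⟩
  tfae_have 3 → 4 := fun ⟨_, h⟩ => Bqo.isAlphaBqo_countableDom h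
  tfae_have 4 → 1 := Bqo.isAlphaBqo_mul_omega0 hα
  tfae_finish
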